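/- Let $\mathbb{H}$ be the quaternions, $\mathbb{B}=\{q\in\mathbb{H}:|q|<1\}$ and $\mathbb{S}=\{I\in\mathbb{H}: I^2=-1\}$. A function $f:\mathbb{B}\to\mathbb{H}$ is called (slice) regular if for every $I\in\mathbb{S}$ the map $(x,y)\mapsto f(x+yI)$ is $C^1$ on the unit disc and satisfies $\left(\frac{\partial}{\partial x}+I\frac{\partial}{\partial y}\right)f(x+yI)=0$. Let $*$ denote the regular product of regular functions (if $f(q)=\sum_n q^n a_n$ and $g(q)=\sum_n q^n b_n$ on $\mathbb{B}$, then $f*g(q)=\sum_n q^n\sum_{k=0}^n a_kb_{n-k}$) and $f^{-*}$ the reciprocal of $f$ with respect to $*$. For $a\in\mathbb{B}$ the Blaschke factor associated with $a$ is $$M_a(q)=(1-q\overline{a})^{-*}*(a-q)\,\frac{\overline{a}}{|a|}\quad (a\neq 0),\qquad M_0(q)=q .$$ **Theorem.** Let $\{a_n\}_{n\in\mathbb{N}}$ be a sequence in $\mathbb{B}$ whose Blaschke product $B=M_{a_0}*M_{a_1}*M_{a_2}*\cdots$ converges uniformly on compact subsets of $\mathbb{B}$. Convergence is understood in the usual sense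 of infinite products: on every compact $C\subset\mathbb{B}$ the partial products $M_{a_0}*\cdots*M_{a_{n}}$ converge uniformly to $B$, and there is an $m$ such that the factors $M_{a_n}$, $n\ge m$, have no zeros in $C$ and the products $M_{a_m}*\cdots*M_{a_{n}}$ converge uniformly on $C$, as $n\to\infty$, to a function without zeros in $C$. Then: 1. $|B(q)|\le 1$ for every $q\in\mathbb{B}$. 2. For almost every $\theta\in\mathbb{R}$, the radial limit $\widetilde B(e^{I\theta})=\lim_{r\to1^-}B(re^{I\theta})$ exists and $|\widetilde B(e^{I\theta})|=1$ for every $I\in\mathbb{S}$, where $e^{I\theta}=\cos\theta+I\sin\theta$. 3. $B$ is an inner function: $B$ is a bounded regular function on $\mathbb{B}$ with $|B|\le 1$ on $\mathbb{B}$, and for almost every $\omega\in\partial\mathbb{B}$ (with respect to surface measure on the unit 3-sphere) the radial limit $\widetilde B(\omega)=\lim_{r\to1^-}B(r\omega)$ exists and has modulus $1$. -/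

import Mathlib

open Quaternion Set Filter Topology MeasureTheory

noncomputable section

/-- The Borel structure on the quaternions; with it `volume` is Lebesgue measure on `ℍ = ℝ⁴`. -/
instance instMeasurableSpaceQuaternionReal : MeasurableSpace ℍ := borel ℍ

instance instBorelSpaceQuaternionReal : BorelSpace ℍ := ⟨rfl⟩

namespace SliceRegular

/-- The open unit ball of the quaternions. -/
def unitBall : Set ℍ := Metric.ball (0 : ℍ) 1

/-- The sphere of imaginary units. -/
def imUnits : Set ℍ := {I | I * I = -1}

/-- `f` is (slice) regular on the unit ball: for every imaginary unit `I` the restriction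
`(x, y) ↦ f (x + y I)` to the unit disc of the slice `ℝ + ℝ I` has continuous partial derivatives
and is annihilated by `∂/∂x + I ∂/∂y`. -/
def IsSliceRegular (f : ℍ → ℍ) : Prop :=
  ∀ I ∈ imUnits,
    ContDiffOn ℝ 1 (fun p : ℝ × ℝ => f ((p.1 : ℍ) + (p.2 : ℍ) * I)) {p | p.1 ^ 2 + p.2 ^ 2 < 1} ∧
    ∀ p : ℝ × ℝ, p.1 ^ 2 + p.2 ^ 2 < 1 →
      fderiv ℝ (fun p : ℝ × ℝ => f ((p.1 : ℍ) + (p.2 : ℍ) * I)) p (1, 0) +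
        I * fderiv ℝ (fun p : ℝ × ℝ => f ((p.1 : ℍ) + (p.2 : ℍ) * I)) p (0, 1) = 0

/-- The quaternion `i`. The slice `ℝ + ℝ i` is identified with `ℂ` by `Quaternion.coeComplex`. -/
def qi : ℍ := ⟨0, 1, 0, 0⟩

/-- The quaternion `j`, an imaginary unit orthogonal to `i`. -/
def qj : ℍ := ⟨0, 0, 1, 0⟩

/-- First splitting component: `f z = F z + G z * j` on the slice `ℂ = ℝ + ℝ i`. -/
def splitF (f : ℍ → ℍ) (z : ℂ) : ℂ := ⟨(f z).re, (f z).imI⟩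

/-- Second splitting component: `f z = F z + G z * j` on the slice `ℂ = ℝ + ℝ i`. -/
def splitG (f : ℍ → ℍ) (z : ℂ) : ℂ := ⟨(f z).imJ, (f z).imK⟩

/-- The imaginary unit `J` with `q = x + y J`, `y > 0`, for non-real `q` (and `0` for real `q`). -/
def unitOf (q : ℍ) : ℍ := (‖q.im‖⁻¹ : ℝ) • q.im

/-- The complex number `x + y i` of the slice `ℂ`, where `q = x + y J`, `y ≥ 0`. -/
def sliceRep (q : ℍ) : ℂ := ⟨q.re, ‖q.im‖⟩

/-- The extension to the quaternions of a function `h` on the slice `ℂ = ℝ + ℝ i`: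
`h (x + y J) = (h (x + y i) + h (x - y i)) / 2 + J (i / 2) (h (x - y i) - h (x + y i))`. -/
def sliceExt (h : ℂ → ℍ) (q : ℍ) : ℍ :=
  (1 / 2 : ℝ) • (h (sliceRep q) + h (star (sliceRep q))) +
    (1 / 2 : ℝ) • (unitOf q * qi * (h (star (sliceRep q)) - h (sliceRep q)))

/-- The regular product `f * g`, defined through the splittings `f = F + G j`, `g = H + K j` on the
slice `ℝ + ℝ i`. For functions regular on the unit ball it does not depend on the choice of
the pair of orthogonal imaginary units `i`, `j`, and its values on the ball depend only on
the values of `f` and `g` on the ball. -/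
def starMul (f g : ℍ → ℍ) : ℍ → ℍ :=
  sliceExt fun z =>
    ((splitF f z * splitF g z - splitG f z * star (splitG g (star z)) : ℂ) : ℍ) +
      ((splitF f z * splitG g z + splitG f z * star (splitF g (star z)) : ℂ) : ℍ) * qj

/-- The regular conjugate `f^c`. -/
def regConj (f : ℍ → ℍ) : ℍ → ℍ :=
  sliceExt fun z => ((star (splitF f (star z)) : ℂ) : ℍ) - (splitG f z : ℍ) * qj

/-- The symmetrization `f^s = f * f^c`. -/
def symmetrization (f : ℍ → ℍ) : ℍ → ℍ := starMul f (regConj f)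

/-- The regular reciprocal `f^{-*} = (f^s)⁻¹ f^c`, meaningful off the zeros of `f^s`. -/
def starInv (f : ℍ → ℍ) (q : ℍ) : ℍ := (symmetrization f q)⁻¹ * regConj f q

open Classical in
/-- The Blaschke factor `M_a(q) = (1 - q ā)^{-*} * (a - q) ā / |a|` for `a ≠ 0`, `M_0(q) = q`. -/
def blaschkeFactor (a : ℍ) : ℍ → ℍ :=
  if a = 0 then fun q => q
  else starMul (starInv fun q => 1 - q * star a)
    (fun q => (a - q) * ((‖a‖⁻¹ : ℝ) • star a))

/-- The finite regular product `f m * f (m + 1) * ⋯ * f (m + n - 1)` (constant `1` for `n = 0`). -/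
def starProd (f : ℕ → ℍ → ℍ) (m : ℕ) : ℕ → ℍ → ℍ
  | 0 => fun _ => 1
  | n + 1 => starMul (starProd f m n) (f (m + n))

/-- The infinite regular product of the `f n` converges to `B` uniformly on compact subsets of the
unit ball, in the usual sense of infinite products: on each compact set the partial products
converge uniformly to `B`, and from some index `m` on the factors have no zeros there and
the residual products `f m * ⋯ * f (m + n - 1)` converge uniformly to a function
without zeros. -/
def HasStarProd (f : ℕ → ℍ → ℍ) (B : ℍ → ℍ) : Prop :=
  ∀ C : Set ℍ, IsCompact C → C ⊆ unitBall →
    TendstoUniformlyOn (starProd f 0) B atTop C ∧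
    ∃ m : ℕ, (∀ n ≥ m, ∀ q ∈ C, f n q ≠ 0) ∧
      ∃ R : ℍ → ℍ, TendstoUniformlyOn (starProd f m) R atTop C ∧ ∀ q ∈ C, R q ≠ 0

/-- `B` is the Blaschke product of the sequence `a` of points of the unit ball. -/
def IsBlaschkeProduct (a : ℕ → ℍ) (B : ℍ → ℍ) : Prop :=
  (∀ n, a n ∈ unitBall) ∧ HasStarProd (fun n => blaschkeFactor (a n)) B

/-- The radial limit of `f` at the boundary point `ω` exists and equals `L`. -/
def HasRadialLimit (f : ℍ → ℍ) (ω L : ℍ) : Prop :=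
  Tendsto (fun r : ℝ => f (r • ω)) (𝓝[<] 1) (𝓝 L)

/-- The Hardy space `H^∞` of bounded regular functions on the unit ball. -/
def MemHInfty (f : ℍ → ℍ) : Prop :=
  IsSliceRegular f ∧ BddAbove ((fun q => ‖f q‖) '' unitBall)

/-- Inner functions; "almost every" refers to surface measure on the unit 3-sphere. -/
def IsInner (f : ℍ → ℍ) : Prop :=
  MemHInfty f ∧ (∀ q ∈ unitBall, ‖f q‖ ≤ 1) ∧
    ∀ᵐ ω : Metric.sphere (0 : ℍ) 1 ∂(volume : Measure ℍ).toSphere,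
      ∃ L : ℍ, HasRadialLimit f ω L ∧ ‖L‖ = 1

end SliceRegular

end

noncomputable section

namespace SliceRegular

/-! ### Fatou's theorem -/

/-! On the slice `ℂ = ℝ + ℝ i` write `f = F + G j` and attach to `f` at `z` the matrix with rows
`(F(z), G(z))` and `(-conj G(z̄), conj F(z̄))`. The regular product becomes the matrix product, and
the determinant `sliceDet` becomes multiplicative. Values on other slices are recovered from those
at `z` and `z̄` (`IsSliceAt`).

The matrix of a Blaschke factor is a contraction on the closed disc, so the same holds for finite
products. A contraction forces modulus at most one on the whole sphere through `z`
(`IsContractiveAt.norm_le_one`), and the bound passes to `B`.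

The determinant of a Blaschke factor is, up to sign, a product of two classical Blaschke factors,
hence unimodular on the circle. Since the residual products have determinant close to one in modulus
at `0`, the circle means of `|det B|` tend to `2π` (`IsBlaschkeProduct.mean_ge`), and the radial
limits of `det B` are unimodular almost everywhere.

Fatou's theorem gives radial limits of `F` and `G` at `e^{iθ}` and `e^{-iθ}`. The limit determinant
`L` is the Hermitian product of two vectors of norm at most one. As `|L| = 1`, equality holds in
Cauchy–Schwarz: the first vector is `L` times the second and both are unit vectors
(`eq_mul_of_norm_eq_one`). Inserted into the extension formula, this gives modulus one for every `I`
at once (`norm_slice_combination`). The exceptional set of angles does not depend on `I`, so it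
lifts to a null set of the 3-sphere (`ae_toSphere_of_ae`). -/

lemma circleIntegrable_mul_of_diffContOnCl {u k : ℂ → ℂ}
    (hu : DiffContOnCl ℂ u (Metric.ball 0 1)) (hk : ContinuousOn k (Metric.sphere 0 1)) :
    CircleIntegrable (fun ζ => k ζ * u ζ) 0 1 := by
  refine ContinuousOn.circleIntegrable zero_le_one (hk.mul (hu.continuousOn.mono ?_))
  rw [closure_ball _ one_ne_zero]
  exact Metric.sphere_subset_closedBall

lemma sub_ofReal_ne_zero {r : ℝ} (hr : r ∈ Ioo (0 : ℝ) 1) {ζ : ℂ} (hζ : ‖ζ‖ = 1) :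
    ζ - (r : ℂ) ≠ 0 := by
  rw [sub_ne_zero]
  rintro rfl
  rw [Complex.norm_real, Real.norm_of_nonneg hr.1.le] at hζ
  linarith [hr.2]

lemma ofReal_mul_sub_one_ne_zero {r : ℝ} (hr : r ∈ Ioo (0 : ℝ) 1) {ζ : ℂ} (hζ : ‖ζ‖ ≤ 1) :
    (r : ℂ) * ζ - 1 ≠ 0 := by
  rw [sub_ne_zero]
  intro h
  have := congrArg norm h
  rw [norm_mul, Complex.norm_real, Real.norm_of_nonneg hr.1.le, norm_one] at this
  nlinarith [hr.1, hr.2, norm_nonneg ζ]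

/-- Cauchy's formula for the derivative at a real point, with the kernel made smaller by
subtracting the one of the reflected point. -/
lemma two_pi_I_mul_deriv_eq {u : ℂ → ℂ} (hu : DiffContOnCl ℂ u (Metric.ball 0 1)) {r : ℝ}
    (hr : r ∈ Ioo (0 : ℝ) 1) :
    2 * Real.pi * Complex.I * deriv u r =
      ∮ ζ in C(0, 1), (((ζ - r) ^ 2)⁻¹ - r ^ 2 * ((r * ζ - 1) ^ 2)⁻¹) * u ζ := by
  have hrb : (r : ℂ) ∈ Metric.ball (0 : ℂ) 1 := by
    rw [mem_ball_zero_iff, Complex.norm_real, Real.norm_of_nonneg hr.1.le]; exact hr.2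
  have hnb : Metric.ball (0 : ℂ) 1 ∈ 𝓝 (r : ℂ) := Metric.isOpen_ball.mem_nhds hrb
  have hcl : closure (Metric.ball (0 : ℂ) 1) = Metric.closedBall 0 1 := closure_ball _ one_ne_zero
  -- The value of `dslope u r` at `r` is the derivative of `u`, so Cauchy's formula for values
  -- suffices.
  have hd : DiffContOnCl ℂ (dslope u r) (Metric.ball 0 1) := by
    refine ⟨(Complex.differentiableOn_dslope hnb).2 hu.differentiableOn, ?_⟩
    exact (continuousOn_dslope (mem_of_superset hnb subset_closure)).2
      ⟨hu.continuousOn, hu.differentiableOn.differentiableAt hnb⟩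
  have h1 := hd.circleIntegral_sub_inv_smul hrb
  rw [dslope_same] at h1
  have hc1 : ContinuousOn (fun ζ : ℂ => ((ζ - r) ^ 2)⁻¹) (Metric.sphere 0 1) :=
    ContinuousOn.inv₀ (by fun_prop) fun ζ hζ =>
      pow_ne_zero _ (sub_ofReal_ne_zero hr (mem_sphere_zero_iff_norm.1 hζ))
  have hc2 : ContinuousOn (fun ζ : ℂ => (r : ℂ) ^ 2 * ((r * ζ - 1) ^ 2)⁻¹)
      (Metric.closedBall 0 1) :=
    continuousOn_const.mul <| ContinuousOn.inv₀ (by fun_prop) fun ζ hζ =>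
      pow_ne_zero _ (ofReal_mul_sub_one_ne_zero hr (mem_closedBall_zero_iff.1 hζ))
  -- The reflected kernel has its only pole at `1 / r`, outside the closed disc, so it contributes
  -- nothing.
  have h2 : ∮ ζ in C(0, 1), ((r : ℂ) ^ 2 * ((r * ζ - 1) ^ 2)⁻¹) * u ζ = 0 := by
    refine DiffContOnCl.circleIntegral_eq_zero zero_le_one ⟨?_, ?_⟩
    · refine DifferentiableOn.mul (DifferentiableOn.mul (by fun_prop)
        (DifferentiableOn.inv (by fun_prop) fun ζ hζ => ?_)) hu.differentiableOn
      exact pow_ne_zero _ (ofReal_mul_sub_one_ne_zero hr (mem_ball_zero_iff.1 hζ).le)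
    · rw [hcl]
      exact hc2.mul (hcl ▸ hu.continuousOn)
  have h3 : ∮ ζ in C(0, 1), ((ζ - r) ^ 2)⁻¹ = 0 := by
    have := circleIntegral.integral_sub_zpow_of_ne (n := -2) (by norm_num) 0 (r : ℂ) 1
    simpa [zpow_neg] using this
  have h4 : ∮ ζ in C(0, 1), (ζ - (r : ℂ))⁻¹ • dslope u r ζ =
      ∮ ζ in C(0, 1), (((ζ - r) ^ 2)⁻¹ * u ζ - u r * ((ζ - r) ^ 2)⁻¹) := by
    refine circleIntegral.integral_congr zero_le_one fun ζ hζ => ?_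
    have h0 := sub_ofReal_ne_zero hr (mem_sphere_zero_iff_norm.1 hζ)
    simp only [dslope_of_ne _ (sub_ne_zero.1 h0), slope_def_field, smul_eq_mul]
    field_simp
  have hi1 := circleIntegrable_mul_of_diffContOnCl hu hc1
  rw [h4, circleIntegral.integral_sub hi1 ((hc1.const_mul (u r)).circleIntegrable zero_le_one),
    circleIntegral.integral_const_mul, h3, mul_zero, sub_zero, smul_eq_mul] at h1
  have h5 := circleIntegral.integral_sub hi1
    (circleIntegrable_mul_of_diffContOnCl hu (hc2.mono Metric.sphere_subset_closedBall))
  rw [h1, h2, sub_zero] at h5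
  rw [← h5]
  simp only [sub_mul]

lemma norm_ofReal_mul_sub_one {r : ℝ} {ζ : ℂ} (hζ : ‖ζ‖ = 1) :
    ‖(r : ℂ) * ζ - 1‖ = ‖ζ - r‖ := by
  have h1 : Complex.normSq ζ = 1 := by rw [Complex.normSq_eq_norm_sq, hζ, one_pow]
  rw [Complex.normSq_apply] at h1
  rw [← sq_eq_sq₀ (norm_nonneg _) (norm_nonneg _), ← Complex.normSq_eq_norm_sq,
    ← Complex.normSq_eq_norm_sq, Complex.normSq_apply, Complex.normSq_apply]
  simp
  linear_combination (r ^ 2 - 1) * h1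

/-- With `x = ζ - r` and `y = rζ - 1`, the numerator `y² - r²x²` factors as `(y - rx)(y + rx)`, and
`y - rx = -(1 - r²)`. On the circle `|y| = |x|`, so subtracting the reflected kernel gains a factor
`(1 - r²) / |x|`, up to a constant. -/
lemma norm_kernel_le {r : ℝ} (hr : r ∈ Ioo (0 : ℝ) 1) {ζ : ℂ} (hζ : ‖ζ‖ = 1) :
    ‖((ζ - (r : ℂ)) ^ 2)⁻¹ - (r : ℂ) ^ 2 * ((r * ζ - 1) ^ 2)⁻¹‖ ≤
      2 * (1 - r ^ 2) / ‖ζ - r‖ ^ 3 := by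
  have h0 := sub_ofReal_ne_zero hr hζ
  have h1 := ofReal_mul_sub_one_ne_zero hr hζ.le
  have hd : 0 < ‖ζ - r‖ := norm_pos_iff.2 h0
  have hr2 : 0 < 1 - r ^ 2 := by nlinarith [hr.1, hr.2]
  have key : ((ζ - (r : ℂ)) ^ 2)⁻¹ - (r : ℂ) ^ 2 * ((r * ζ - 1) ^ 2)⁻¹ =
      -(((1 - r ^ 2 : ℝ) : ℂ) * ((r * ζ - 1) + r * (ζ - r))) / ((ζ - r) ^ 2 * (r * ζ - 1) ^ 2) := by
    have h3 : ∀ x y : ℂ, x ≠ 0 → y ≠ 0 →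
        (x ^ 2)⁻¹ - (r : ℂ) ^ 2 * (y ^ 2)⁻¹ = (y ^ 2 - r ^ 2 * x ^ 2) / (x ^ 2 * y ^ 2) := by
      intro x y hx hy
      field_simp
    rw [h3 _ _ h0 h1]
    push_cast
    ring
  have h2 : ‖((r : ℂ) * ζ - 1) + r * (ζ - r)‖ ≤ 2 * ‖ζ - r‖ := by
    refine (norm_add_le _ _).trans ?_
    rw [norm_ofReal_mul_sub_one hζ, norm_mul, Complex.norm_real, Real.norm_of_nonneg hr.1.le]
    nlinarith [hr.2]
  rw [key, norm_div, norm_neg, norm_mul, Complex.norm_real, Real.norm_of_nonneg hr2.le, norm_mul,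
    norm_pow, norm_pow, norm_ofReal_mul_sub_one hζ, div_le_div_iff₀ (by positivity) (by positivity)]
  calc (1 - r ^ 2) * ‖((r : ℂ) * ζ - 1) + r * (ζ - r)‖ * ‖ζ - r‖ ^ 3
      ≤ (1 - r ^ 2) * (2 * ‖ζ - r‖) * ‖ζ - r‖ ^ 3 := by gcongr
    _ = 2 * (1 - r ^ 2) * (‖ζ - r‖ ^ 2 * ‖ζ - r‖ ^ 2) := by ring

/-- Lets a bound on `u` in terms of the distance to `1` cancel powers of `|ζ - r|` in the kernel,
leaving the Poisson kernel. -/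
lemma norm_sub_one_le_two_mul {r : ℝ} (hr : r ∈ Ioo (0 : ℝ) 1) {ζ : ℂ} (hζ : ‖ζ‖ = 1) :
    ‖ζ - 1‖ ≤ 2 * ‖ζ - r‖ := by
  have h1 : ‖ζ - 1‖ ≤ ‖ζ - r‖ + ‖(r : ℂ) - 1‖ := by
    simpa using norm_add_le (ζ - (r : ℂ)) (r - 1)
  have h2 : ‖(r : ℂ) - 1‖ = 1 - r := by
    rw [← Complex.ofReal_one, ← Complex.ofReal_sub, Complex.norm_real, Real.norm_eq_abs,
      abs_of_neg (by linarith [hr.2])]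
    ring
  have h3 : 1 - r ≤ ‖ζ - r‖ := by
    have := norm_sub_norm_le ζ (r : ℂ)
    rwa [hζ, Complex.norm_real, Real.norm_of_nonneg hr.1.le] at this
  linarith

/-- The total mass of the Poisson kernel. -/
lemma integral_poisson_eq {r : ℝ} (hr : r ∈ Ioo (0 : ℝ) 1) :
    ∫ θ in (0 : ℝ)..2 * Real.pi, (1 - r ^ 2) / ‖circleMap 0 1 θ - r‖ ^ 2 = 2 * Real.pi := by
  have hrb : (r : ℂ) ∈ Metric.ball (0 : ℂ) 1 := by
    rw [mem_ball_zero_iff, Complex.norm_real, Real.norm_of_nonneg hr.1.le]; exact hr.2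
  have h : Real.circleAverage _ _ _ = (1 : ℂ) := DiffContOnCl.circleAverage_poissonKernel_smul'
    (f := fun _ => (1 : ℂ)) diffContOnCl_const hrb
  have h2 : ∀ θ : ℝ, ((‖circleMap 0 1 θ - 0‖ ^ 2 - ‖(r : ℂ) - 0‖ ^ 2) /
      ‖circleMap 0 1 θ - 0 - ((r : ℂ) - 0)‖ ^ 2) • (1 : ℂ) =
      (((1 - r ^ 2) / ‖circleMap 0 1 θ - r‖ ^ 2 : ℝ) : ℂ) := by
    intro θ
    simp
  rw [Real.circleAverage_def] at h
  simp only [h2] at h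
  rw [intervalIntegral.integral_ofReal, Complex.real_smul, ← Complex.ofReal_mul,
    Complex.ofReal_eq_one, inv_mul_eq_one₀ Real.two_pi_pos.ne'] at h
  exact h.symm

/-- A holomorphic function that is continuous up to the boundary and vanishes to higher than
first order at `1` along the circle has a derivative tending radially to `0` at `1`. -/
lemma tendsto_deriv_zero {u : ℂ → ℂ} (hu : DiffContOnCl ℂ u (Metric.ball 0 1))
    (h : ∀ ε > 0, ∃ δ > 0, ∀ ζ : ℂ, ‖ζ‖ = 1 → ‖ζ - 1‖ < δ → ‖u ζ‖ ≤ ε * ‖ζ - 1‖) :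
    Tendsto (fun r : ℝ => deriv u r) (𝓝[<] 1) (𝓝 0) := by
  have hcl : closure (Metric.ball (0 : ℂ) 1) = Metric.closedBall 0 1 := closure_ball _ one_ne_zero
  obtain ⟨C, hC⟩ := (isCompact_sphere (0 : ℂ) 1).exists_bound_of_continuousOn
    (hu.continuousOn.mono (by rw [hcl]; exact Metric.sphere_subset_closedBall))
  have key : ∀ ε > 0, ∃ M : ℝ, ∀ r ∈ Ioo (0 : ℝ) 1,
      ‖deriv u r‖ ≤ 4 * ε + M * (1 - r ^ 2) := by
    intro ε hε
    obtain ⟨δ, hδ, hu1⟩ := h ε hε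
    have hC0 : 0 ≤ C := (norm_nonneg _).trans (hC 1 (by simp))
    refine ⟨16 * (C / δ ^ 3), fun r hr => ?_⟩
    have hr2 : 0 < 1 - r ^ 2 := by nlinarith [hr.1, hr.2]
    -- Far from `1` the constant bound is traded for a cubic one: the cube cancels the denominator
    -- of the kernel bound and leaves a term that vanishes with `1 - r²`.
    have hbound : ∀ ζ : ℂ, ‖ζ‖ = 1 → ‖u ζ‖ ≤ ε * ‖ζ - 1‖ + C / δ ^ 3 * ‖ζ - 1‖ ^ 3 := by
      intro ζ hζ
      rcases lt_or_ge ‖ζ - 1‖ δ with h1 | h1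
      · exact (hu1 ζ hζ h1).trans (le_add_of_nonneg_right (by positivity))
      · refine (hC ζ (by simpa using hζ)).trans ?_
        have : C ≤ C / δ ^ 3 * ‖ζ - 1‖ ^ 3 := by
          rw [div_mul_eq_mul_div, le_div_iff₀ (by positivity)]
          gcongr
        nlinarith [norm_nonneg (ζ - 1)]
    have hpt : ∀ ζ : ℂ, ‖ζ‖ = 1 →
        ‖(((ζ - (r : ℂ)) ^ 2)⁻¹ - (r : ℂ) ^ 2 * ((r * ζ - 1) ^ 2)⁻¹) * u ζ‖ ≤
          4 * ε * ((1 - r ^ 2) / ‖ζ - r‖ ^ 2) + 16 * (C / δ ^ 3) * (1 - r ^ 2) := by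
      intro ζ hζ
      have hd : 0 < ‖ζ - r‖ := norm_pos_iff.2 (sub_ofReal_ne_zero hr hζ)
      have h2 := norm_sub_one_le_two_mul hr hζ
      rw [norm_mul]
      calc _ ≤ 2 * (1 - r ^ 2) / ‖ζ - r‖ ^ 3 *
            (ε * (2 * ‖ζ - r‖) + C / δ ^ 3 * (2 * ‖ζ - r‖) ^ 3) := by
            refine mul_le_mul (norm_kernel_le hr hζ) ((hbound ζ hζ).trans ?_) (norm_nonneg _)
              (by positivity)
            gcongr
        _ = _ := by field_simp; ring
    have hci : IntervalIntegrable (fun θ => (1 - r ^ 2) / ‖circleMap 0 1 θ - r‖ ^ 2) volume 0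
        (2 * Real.pi) := by
      refine Continuous.intervalIntegrable (Continuous.div (by fun_prop) (by fun_prop) ?_) _ _
      intro θ
      exact pow_ne_zero _ (norm_ne_zero_iff.2 (sub_ofReal_ne_zero hr (by simp)))
    have hI : ‖2 * Real.pi * Complex.I * deriv u r‖ ≤ ∫ θ in (0 : ℝ)..2 * Real.pi,
        (4 * ε * ((1 - r ^ 2) / ‖circleMap 0 1 θ - r‖ ^ 2) + 16 * (C / δ ^ 3) * (1 - r ^ 2)) := by
      rw [two_pi_I_mul_deriv_eq hu hr]
      refine intervalIntegral.norm_integral_le_of_norm_le Real.two_pi_pos.le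
        (ae_of_all _ fun θ _ => ?_) ((hci.const_mul _).add (by simp))
      rw [norm_smul, deriv_circleMap]
      simpa using hpt (circleMap 0 1 θ) (by simp)
    rw [intervalIntegral.integral_add (hci.const_mul _) (by simp),
      intervalIntegral.integral_const_mul, integral_poisson_eq hr, intervalIntegral.integral_const,
      norm_mul] at hI
    have hpi := Real.pi_pos
    have h5 : ‖(2 : ℂ) * Real.pi * Complex.I‖ = 2 * Real.pi := by
      simp [abs_of_pos hpi]
    rw [h5, smul_eq_mul, sub_zero] at hI
    refine le_of_mul_le_mul_left ?_ Real.two_pi_pos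
    linarith
  rw [Metric.tendsto_nhds]
  intro ε hε
  obtain ⟨M, hM⟩ := key (ε / 8) (by positivity)
  have hlim : Tendsto (fun r : ℝ => 4 * (ε / 8) + M * (1 - r ^ 2)) (𝓝[<] 1) (𝓝 (ε / 2)) := by
    have : Continuous fun r : ℝ => 4 * (ε / 8) + M * (1 - r ^ 2) := by fun_prop
    have h1 := (this.tendsto 1).mono_left (nhdsWithin_le_nhds (s := Iio 1))
    convert h1 using 2
    ring
  filter_upwards [hlim.eventually (gt_mem_nhds (half_lt_self hε)),
    Ioo_mem_nhdsLT (zero_lt_one' ℝ)] with r h1 h2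
  rw [dist_zero_right]
  exact (hM r h2).trans_lt h1

/-- Converts smallness in the angle into smallness in the chord, by `|arg ζ| ≤ (π/2) |ζ - 1|` on the
circle. -/
lemma norm_le_mul_norm_sub_one_of_hasDerivAt {u : ℂ → ℂ} (h1 : u 1 = 0)
    (hu : HasDerivAt (fun t : ℝ => u (Complex.exp (t * Complex.I))) 0 0) {ε : ℝ} (hε : 0 < ε) :
    ∃ δ > 0, ∀ ζ : ℂ, ‖ζ‖ = 1 → ‖ζ - 1‖ < δ → ‖u ζ‖ ≤ ε * ‖ζ - 1‖ := by
  have hπ := Real.pi_pos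
  have h2 := (hasDerivAt_iff_isLittleO.1 hu).def (c := ε * (2 / Real.pi)) (by positivity)
  have h3 : Tendsto Complex.arg (𝓝 1) (𝓝 0) := by
    simpa using (Complex.continuousAt_arg (x := 1) (by simp)).tendsto
  obtain ⟨δ, hδ, h4⟩ := Metric.eventually_nhds_iff.1 (h3.eventually h2)
  refine ⟨δ, hδ, fun ζ hζ hd => ?_⟩
  have h5 := h4 (y := ζ) (by rwa [dist_eq_norm])
  have h6 : Complex.exp (ζ.arg * Complex.I) = ζ := by
    have := Complex.norm_mul_exp_arg_mul_I ζ
    rwa [hζ, Complex.ofReal_one, one_mul] at this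
  simp only [h6, Complex.ofReal_zero, zero_mul, Complex.exp_zero, h1, smul_zero, sub_zero] at h5
  have h7 := Complex.angle_le_mul_norm_sub (x := 1) (y := ζ) (by simp) hζ
  rw [Complex.angle_one_left (by rintro rfl; simp at hζ), norm_sub_rev] at h7
  calc ‖u ζ‖ ≤ ε * (2 / Real.pi) * |ζ.arg| := h5
    _ ≤ ε * (2 / Real.pi) * (Real.pi / 2 * ‖ζ - 1‖) := by gcongr
    _ = ε * ‖ζ - 1‖ := by field_simp

/-- **Fatou's theorem**: a bounded holomorphic function on the unit disc has radial limits almost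
everywhere. -/
theorem ae_exists_radial_limit {f : ℂ → ℂ} (hf : DifferentiableOn ℂ f (Metric.ball 0 1)) {C : ℝ}
    (hC : ∀ z ∈ Metric.ball (0 : ℂ) 1, ‖f z‖ ≤ C) :
    ∀ᵐ θ : ℝ, ∃ l : ℂ, Tendsto (fun r : ℝ => f (r * Complex.exp (θ * Complex.I))) (𝓝[<] 1) (𝓝 l) := by
  -- A primitive of a bounded function is Lipschitz; extended to the closed disc, it is
  -- differentiable along the circle at almost every angle, and `f` is recovered radially as its
  -- derivative.
  obtain ⟨F, hF⟩ := hf.isExactOn_ball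
  have hC0 : 0 ≤ C := (norm_nonneg _).trans (hC 0 (by simp))
  have hLip : LipschitzOnWith C.toNNReal F (Metric.ball 0 1) := by
    refine Convex.lipschitzOnWith_of_nnnorm_deriv_le (𝕜 := ℂ)
      (fun z hz => (hF z hz).differentiableAt) (fun z hz => ?_) (convex_ball _ _)
    rw [(hF z hz).deriv, ← NNReal.coe_le_coe, coe_nnnorm, Real.coe_toNNReal _ hC0]
    exact hC z hz
  obtain ⟨g, hg, hgF⟩ := hLip.extend_finite_dimension
  have hgd : ∀ z ∈ Metric.ball (0 : ℂ) 1, HasDerivAt g (f z) z := fun z hz =>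
    (hF z hz).congr_of_eventuallyEq
      (eventually_of_mem (Metric.isOpen_ball.mem_nhds hz) fun w hw => (hgF hw).symm)
  have hgc : LipschitzWith _ (fun θ : ℝ => g (circleMap 0 1 θ)) :=
    hg.comp (lipschitzWith_circleMap 0 1)
  filter_upwards [hgc.ae_differentiableAt_real] with θ hθ
  set w : ℂ := Complex.exp (θ * Complex.I) with hw
  have hwn : ‖w‖ = 1 := Complex.norm_exp_ofReal_mul_I θ
  have hw0 : w ≠ 0 := Complex.exp_ne_zero _
  set D := deriv (fun θ : ℝ => g (circleMap 0 1 θ)) θ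
  -- `β` is the complex derivative at `w` that matches the tangential derivative `D`; the function
  -- `u` below is the rotated primitive minus its first-order part, so that `u'(r) = w (f(wr) - β)`.
  set β : ℂ := D / (Complex.I * w)
  have hmap : ∀ z ∈ Metric.ball (0 : ℂ) 1, w * z ∈ Metric.ball (0 : ℂ) 1 := by
    intro z hz
    simpa [hwn] using hz
  let u : ℂ → ℂ := fun z => g (w * z) - g w - β * w * (z - 1)
  have hud : ∀ z ∈ Metric.ball (0 : ℂ) 1, HasDerivAt u (w * f (w * z) - β * w) z := by
    intro z hz
    have h1 : HasDerivAt (fun z => g (w * z)) (f (w * z) * w) z :=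
      (hgd _ (hmap z hz)).comp z (by simpa using (hasDerivAt_id z).const_mul w)
    have h2 : HasDerivAt (fun z : ℂ => β * w * (z - 1)) (β * w) z := by
      simpa using ((hasDerivAt_id z).sub_const 1).const_mul (β * w)
    rw [mul_comm w]
    exact (h1.sub_const (g w)).sub h2
  have hu : DiffContOnCl ℂ u (Metric.ball 0 1) := by
    refine ⟨fun z hz => (hud z hz).differentiableAt.differentiableWithinAt, ?_⟩
    have := hg.continuous
    exact Continuous.continuousOn (by fun_prop)
  have hderiv : HasDerivAt (fun t : ℝ => u (Complex.exp (t * Complex.I))) 0 0 := by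
    have h1 : HasDerivAt (fun t : ℝ => g (w * Complex.exp (t * Complex.I))) D 0 := by
      have h2 : HasDerivAt (fun θ : ℝ => g (circleMap 0 1 θ)) D (θ + 0) := by
        rw [add_zero]
        exact hθ.hasDerivAt
      have h3 : (fun t : ℝ => g (w * Complex.exp (t * Complex.I))) =
          fun t : ℝ => g (circleMap 0 1 (θ + t)) := by
        funext t
        simp [circleMap, hw, add_mul, Complex.exp_add]
      rw [h3]
      exact h2.comp_const_add θ 0
    have h3 : HasDerivAt (fun t : ℝ => β * w * (Complex.exp (t * Complex.I) - 1))
        (β * w * Complex.I) 0 := by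
      have h4 : HasDerivAt (fun t : ℝ => Complex.exp (t * Complex.I)) Complex.I 0 := by
        have := hasDerivAt_circleMap 0 1 0
        unfold circleMap at this
        simpa using this
      exact (h4.sub_const 1).const_mul _
    have h5 : β * w * Complex.I = D := by
      simp only [β]
      field_simp
    rw [h5] at h3
    have h6 := (h1.sub_const (g w)).sub h3
    rwa [sub_self] at h6
  have hlim := tendsto_deriv_zero hu fun ε hε =>
    norm_le_mul_norm_sub_one_of_hasDerivAt (by simp [u]) hderiv hε
  refine ⟨β, ?_⟩
  have h5 : Tendsto (fun r : ℝ => w⁻¹ * deriv u r + β) (𝓝[<] 1) (𝓝 (w⁻¹ * 0 + β)) :=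
    (hlim.const_mul _).add_const _
  rw [mul_zero, zero_add] at h5
  refine h5.congr' ?_
  filter_upwards [Ioo_mem_nhdsLT (zero_lt_one' ℝ)] with r hr
  have hrb : (r : ℂ) ∈ Metric.ball (0 : ℂ) 1 := by
    rw [mem_ball_zero_iff, Complex.norm_real, Real.norm_of_nonneg hr.1.le]; exact hr.2
  rw [(hud r hrb).deriv, mul_comm (r : ℂ) w]
  field_simp
  ring

/-! ### Imaginary units -/

@[simp] lemma qi_re : qi.re = 0 := rfl
@[simp] lemma qi_imI : qi.imI = 1 := rfl
@[simp] lemma qi_imJ : qi.imJ = 0 := rfl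
@[simp] lemma qi_imK : qi.imK = 0 := rfl
@[simp] lemma qj_re : qj.re = 0 := rfl
@[simp] lemma qj_imI : qj.imI = 0 := rfl
@[simp] lemma qj_imJ : qj.imJ = 1 := rfl
@[simp] lemma qj_imK : qj.imK = 0 := rfl

lemma mem_imUnits_iff {I : ℍ} :
    I ∈ imUnits ↔ I.re = 0 ∧ I.imI ^ 2 + I.imJ ^ 2 + I.imK ^ 2 = 1 := by
  simp only [imUnits, mem_ofPred_eq, Quaternion.ext_iff, Quaternion.re_mul, Quaternion.imI_mul,
    Quaternion.imJ_mul, Quaternion.imK_mul, Quaternion.re_neg, Quaternion.imI_neg,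
    Quaternion.imJ_neg, Quaternion.imK_neg, Quaternion.re_one, Quaternion.imI_one,
    Quaternion.imJ_one, Quaternion.imK_one]
  constructor
  · rintro ⟨h1, h2, h3, h4⟩
    have hre : I.re = 0 := by
      by_contra h
      have e2 : I.imI = 0 := by
        have : I.re * I.imI = 0 := by linarith
        simpa [h] using this
      have e3 : I.imJ = 0 := by
        have : I.re * I.imJ = 0 := by linarith
        simpa [h] using this
      have e4 : I.imK = 0 := by
        have : I.re * I.imK = 0 := by linarith
        simpa [h] using this
      rw [e2, e3, e4] at h1
      nlinarith [sq_nonneg I.re]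
    rw [hre] at h1
    exact ⟨hre, by linarith⟩
  · rintro ⟨h1, h2⟩
    rw [h1]
    exact ⟨by linarith, by ring, by ring, by ring⟩

lemma norm_sq_eq (q : ℍ) : ‖q‖ ^ 2 = q.re ^ 2 + q.imI ^ 2 + q.imJ ^ 2 + q.imK ^ 2 := by
  rw [sq, ← Quaternion.normSq_eq_norm_mul_self, Quaternion.normSq_def']

lemma norm_eq_one_of_mem_imUnits {I : ℍ} (hI : I ∈ imUnits) : ‖I‖ = 1 := by
  obtain ⟨h1, h2⟩ := mem_imUnits_iff.1 hI
  rw [← sq_eq_sq₀ (norm_nonneg _) zero_le_one, norm_sq_eq, h1]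
  linarith

lemma qi_mem_imUnits : qi ∈ imUnits := mem_imUnits_iff.2 (by simp)

lemma coeComplex_eq (z : ℂ) : (z : ℍ) = (z.re : ℍ) + (z.im : ℍ) * qi := by
  ext <;> simp

lemma norm_add_mul_imUnit {I : ℍ} (hI : I ∈ imUnits) (z : ℂ) :
    ‖(z.re : ℍ) + (z.im : ℍ) * I‖ = ‖z‖ := by
  obtain ⟨h1, h2⟩ := mem_imUnits_iff.1 hI
  rw [← sq_eq_sq₀ (norm_nonneg _) (norm_nonneg _), norm_sq_eq, ← Complex.normSq_eq_norm_sq,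
    Complex.normSq_apply]
  simp [h1]
  linear_combination z.im ^ 2 * h2

lemma norm_coeComplex (z : ℂ) : ‖(z : ℍ)‖ = ‖z‖ := by
  rw [coeComplex_eq, norm_add_mul_imUnit qi_mem_imUnits]

lemma exists_imUnit_eq (q : ℍ) : ∃ I ∈ imUnits, q = ((sliceRep q).re : ℍ) + ((sliceRep q).im : ℍ) * I := by
  by_cases h : q.im = 0
  · refine ⟨qi, qi_mem_imUnits, ?_⟩
    simp only [sliceRep, h, norm_zero, Quaternion.coe_zero, zero_mul, add_zero]
    rw [← Quaternion.re_add_im q, h, add_zero, Quaternion.re_coe]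
  · have hn : ‖q.im‖ ≠ 0 := norm_ne_zero_iff.2 h
    have hn2 := norm_sq_eq q.im
    simp only [Quaternion.re_im, Quaternion.imI_im, Quaternion.imJ_im, Quaternion.imK_im] at hn2
    refine ⟨unitOf q, mem_imUnits_iff.2 ⟨by simp [unitOf], ?_⟩, ?_⟩
    · simp [unitOf]
      field_simp
      linarith
    · simp only [sliceRep, unitOf]
      rw [← Quaternion.coe_mul_eq_smul, ← mul_assoc, ← Quaternion.coe_mul, mul_inv_cancel₀ hn,
        Quaternion.coe_one, one_mul, Quaternion.re_add_im]

lemma norm_sliceRep (q : ℍ) : ‖sliceRep q‖ = ‖q‖ := by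
  obtain ⟨I, hI, h⟩ := exists_imUnit_eq q
  conv_rhs => rw [h]
  exact (norm_add_mul_imUnit hI _).symm

/-! ### The extension formula -/

lemma im_add_mul_imUnit {I : ℍ} (hI : I ∈ imUnits) (z : ℂ) :
    ((z.re : ℍ) + (z.im : ℍ) * I).im = z.im • I := by
  obtain ⟨h1, h2⟩ := mem_imUnits_iff.1 hI
  ext <;> simp [h1]

/-- The extension formula holds in every slice, with any sign of the imaginary part. -/
lemma sliceExt_apply {I : ℍ} (hI : I ∈ imUnits) (h : ℂ → ℍ) (z : ℂ) :
    sliceExt h ((z.re : ℍ) + (z.im : ℍ) * I) =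
      (1 / 2 : ℝ) • (h z + h (star z)) + (1 / 2 : ℝ) • (I * qi * (h (star z) - h z)) := by
  have hre : ((z.re : ℍ) + (z.im : ℍ) * I).re = z.re := by simp [(mem_imUnits_iff.1 hI).1]
  have him : ‖((z.re : ℍ) + (z.im : ℍ) * I).im‖ = |z.im| := by
    rw [im_add_mul_imUnit hI, norm_smul, norm_eq_one_of_mem_imUnits hI, mul_one, Real.norm_eq_abs]
  rcases lt_trichotomy z.im 0 with hz | hz | hz
  -- For `y < 0` the representative is conjugated and the unit changes sign; the two changes cancel
  -- in the formula.
  · have hs : sliceRep ((z.re : ℍ) + (z.im : ℍ) * I) = star z := by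
      exact Complex.ext hre (him.trans (abs_of_neg hz))
    have hu : unitOf ((z.re : ℍ) + (z.im : ℍ) * I) = -I := by
      rw [unitOf, him, im_add_mul_imUnit hI, smul_smul, abs_of_neg hz, inv_neg, neg_mul,
        inv_mul_cancel₀ hz.ne, neg_one_smul]
    rw [sliceExt, hs, hu, star_star, add_comm (h (star z))]
    congr 2
    noncomm_ring
  · have hs : star z = z := by apply Complex.ext <;> simp [hz]
    have hs' : sliceRep ((z.re : ℍ) + (z.im : ℍ) * I) = z := by
      exact Complex.ext hre (him.trans (by rw [hz, abs_zero]))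
    rw [sliceExt, hs', hs]
    simp
  · have hs : sliceRep ((z.re : ℍ) + (z.im : ℍ) * I) = z := by
      exact Complex.ext hre (him.trans (abs_of_pos hz))
    have hu : unitOf ((z.re : ℍ) + (z.im : ℍ) * I) = I := by
      rw [unitOf, him, im_add_mul_imUnit hI, smul_smul, abs_of_pos hz,
        inv_mul_cancel₀ hz.ne', one_smul]
    rw [sliceExt, hs, hu]

lemma sliceExt_coeComplex (h : ℂ → ℍ) (z : ℂ) : sliceExt h z = h z := by
  rw [coeComplex_eq, sliceExt_apply qi_mem_imUnits,
    show qi * qi = -1 from qi_mem_imUnits]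
  rw [← smul_add]
  have : h z + h (star z) + -1 * (h (star z) - h z) = (2 : ℝ) • h z := by
    rw [two_smul]; noncomm_ring
  rw [this, smul_smul]
  norm_num

/-- `f` is determined on the sphere through `z` by its values at `z` and `star z`. -/
def IsSliceAt (f : ℍ → ℍ) (z : ℂ) : Prop :=
  ∀ I ∈ imUnits, f ((z.re : ℍ) + (z.im : ℍ) * I) =
      (1 / 2 : ℝ) • (f z + f (star z : ℂ)) +
        (1 / 2 : ℝ) • (I * qi * (f (star z : ℂ) - f z))

lemma isSliceAt_sliceExt (h : ℂ → ℍ) (z : ℂ) : IsSliceAt (sliceExt h) z := by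
  intro I hI
  rw [sliceExt_apply hI, sliceExt_coeComplex, sliceExt_coeComplex]

lemma isSliceAt_const (c : ℍ) (z : ℂ) : IsSliceAt (fun _ => c) z := by
  intro I _
  rw [sub_self, mul_zero, smul_zero, add_zero, ← two_smul ℝ c, smul_smul]
  norm_num

lemma eq_split (f : ℍ → ℍ) (z : ℂ) : f z = (splitF f z : ℍ) + (splitG f z : ℍ) * qj := by
  ext <;> simp [splitF, splitG]

lemma split_of_eq {f : ℍ → ℍ} {z F G : ℂ} (h : f z = (F : ℍ) + (G : ℍ) * qj) :
    splitF f z = F ∧ splitG f z = G := by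
  constructor <;> apply Complex.ext <;> simp [splitF, splitG, h]

lemma splitF_starMul (f g : ℍ → ℍ) (z : ℂ) : splitF (starMul f g) z =
    splitF f z * splitF g z - splitG f z * star (splitG g (star z)) :=
  (split_of_eq (sliceExt_coeComplex _ z)).1

lemma splitG_starMul (f g : ℍ → ℍ) (z : ℂ) : splitG (starMul f g) z =
    splitF f z * splitG g z + splitG f z * star (splitF g (star z)) :=
  (split_of_eq (sliceExt_coeComplex _ z)).2

lemma regConj_coeComplex (f : ℍ → ℍ) (z : ℂ) :
    regConj f z = ((star (splitF f (star z)) : ℂ) : ℍ) + ((-splitG f z : ℂ) : ℍ) * qj := by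
  rw [regConj, sliceExt_coeComplex]
  ext <;> simp

/-- The determinant of the matrix attached to `f` at `z`: the symmetrization of `f` on the
slice `ℂ`. -/
def sliceDet (f : ℍ → ℍ) (z : ℂ) : ℂ :=
  splitF f z * star (splitF f (star z)) + splitG f z * star (splitG f (star z))

/-- The conjugate `f^c` corresponds to the adjugate matrix, so the `j`-component of `f * f^c`
cancels and only the determinant remains. -/
lemma symmetrization_coeComplex (f : ℍ → ℍ) (z : ℂ) :
    symmetrization f z = (sliceDet f z : ℂ) := by
  have h := fun z => split_of_eq (regConj_coeComplex f z)
  rw [eq_split (symmetrization f), symmetrization, splitF_starMul, splitG_starMul, (h _).1, (h _).1,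
    (h _).2, (h _).2, sliceDet]
  simp only [star_star, star_neg, mul_neg, sub_neg_eq_add]
  rw [mul_comm (splitG f z) (splitF f z), neg_add_cancel, Quaternion.coeComplex_zero, zero_mul,
    add_zero]

/-- Multiplicativity of the determinant under the matrix product. -/
lemma sliceDet_starMul (f g : ℍ → ℍ) (z : ℂ) :
    sliceDet (starMul f g) z = sliceDet f z * sliceDet g z := by
  simp only [sliceDet, splitF_starMul, splitG_starMul, star_star, star_sub, star_add, star_mul']
  ring

lemma normSq_split_add (f : ℍ → ℍ) (z : ℂ) :
    Complex.normSq (splitF f z) + Complex.normSq (splitG f z) = ‖f z‖ ^ 2 := by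
  rw [norm_sq_eq, Complex.normSq_apply, Complex.normSq_apply]
  simp only [splitF, splitG]
  ring

/-! ### Contractions -/

/-- First entry of the row vector `(u, v)` times the matrix of `f` at `z`. -/
def rowFst (f : ℍ → ℍ) (z u v : ℂ) : ℂ := u * splitF f z - v * star (splitG f (star z))

/-- Second entry of the row vector `(u, v)` times the matrix of `f` at `z`. -/
def rowSnd (f : ℍ → ℍ) (z u v : ℂ) : ℂ := u * splitG f z + v * star (splitF f (star z))

/-- The matrix of `f` at `z` is a contraction. -/
def IsContractiveAt (f : ℍ → ℍ) (z : ℂ) : Prop :=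
  ∀ u v : ℂ, Complex.normSq (rowFst f z u v) + Complex.normSq (rowSnd f z u v) ≤
    Complex.normSq u + Complex.normSq v

lemma rowFst_starMul (f g : ℍ → ℍ) (z u v : ℂ) :
    rowFst (starMul f g) z u v = rowFst g z (rowFst f z u v) (rowSnd f z u v) := by
  simp only [rowFst, rowSnd, splitF_starMul, splitG_starMul, star_star, star_add, star_mul']
  ring

lemma rowSnd_starMul (f g : ℍ → ℍ) (z u v : ℂ) :
    rowSnd (starMul f g) z u v = rowSnd g z (rowFst f z u v) (rowSnd f z u v) := by
  simp only [rowFst, rowSnd, splitF_starMul, splitG_starMul, star_star, star_sub, star_mul']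
  ring

lemma IsContractiveAt.starMul {f g : ℍ → ℍ} {z : ℂ} (hf : IsContractiveAt f z)
    (hg : IsContractiveAt g z) : IsContractiveAt (starMul f g) z := by
  intro u v
  rw [rowFst_starMul, rowSnd_starMul]
  exact (hg _ _).trans (hf u v)

/-- `k = 1 - iI` works, since both sides equal `i + I`. It vanishes only for `I = -i`, where `j`
serves instead. -/
lemma exists_conj_imUnit {I : ℍ} (hI : I ∈ imUnits) : ∃ k : ℍ, k ≠ 0 ∧ k * I = qi * k := by
  have hI2 : I * I = -1 := hI
  have hq2 : qi * qi = -1 := qi_mem_imUnits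
  by_cases h : 1 - qi * I = 0
  · have h1 : I = -qi := by
      have : qi * (1 - qi * I) = qi + I := by
        rw [mul_sub, mul_one, ← mul_assoc, hq2]; noncomm_ring
      rw [h, mul_zero] at this
      exact eq_neg_of_add_eq_zero_right this.symm
    refine ⟨qj, fun h0 => ?_, ?_⟩
    · simpa using congrArg (fun q : ℍ => q.imJ) h0
    · rw [h1]
      ext <;> simp
  · refine ⟨_, h, ?_⟩
    rw [sub_mul, mul_sub, mul_assoc, hI2, ← mul_assoc, hq2]
    noncomm_ring

/-- Multiplying by `k` on the left turns `I` into `i` in the extension formula, and `(k ∓ iki)/2`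
are the projections of `k` onto `ℂ` and `ℂ j`. A value on the slice of `I` thus becomes a row vector
times the matrix of `f`. -/
lemma mul_slice_eq {I k A B : ℍ} (hk : k * I = qi * k) :
    k * ((1 / 2 : ℝ) • (A + B) + (1 / 2 : ℝ) • (I * qi * (B - A))) =
      ((⟨k.re, k.imI⟩ : ℂ) : ℍ) * A + ((⟨k.imJ, k.imK⟩ : ℂ) : ℍ) * qj * B := by
  have h1 : ((⟨k.re, k.imI⟩ : ℂ) : ℍ) = (1 / 2 : ℝ) • (k - qi * k * qi) := by
    ext <;> simp <;> ring
  have h2 : ((⟨k.imJ, k.imK⟩ : ℂ) : ℍ) * qj = (1 / 2 : ℝ) • (k + qi * k * qi) := by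
    ext <;> simp <;> ring
  rw [h1, h2, mul_add, mul_smul_comm, mul_smul_comm, ← mul_assoc, ← mul_assoc k I qi, hk,
    smul_mul_assoc, smul_mul_assoc, ← smul_add, ← smul_add]
  congr 1
  noncomm_ring

lemma IsContractiveAt.norm_le_one {f : ℍ → ℍ} {z : ℂ} (hf : IsContractiveAt f z)
    (hs : IsSliceAt f z) {I : ℍ} (hI : I ∈ imUnits) :
    ‖f ((z.re : ℍ) + (z.im : ℍ) * I)‖ ≤ 1 := by
  obtain ⟨k, hk0, hk⟩ := exists_conj_imUnit hI
  have h1 := mul_slice_eq (A := f z) (B := f (star z : ℂ)) hk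
  rw [← hs I hI] at h1
  have h2 := hf ⟨k.re, k.imI⟩ ⟨k.imJ, k.imK⟩
  have h3 : ‖k * f ((z.re : ℍ) + (z.im : ℍ) * I)‖ ^ 2 ≤ ‖k‖ ^ 2 := by
    rw [h1, norm_sq_eq, norm_sq_eq]
    simp only [rowFst, rowSnd, splitF, splitG, Complex.normSq_apply] at h2
    simp at h2 ⊢
    linarith
  rw [norm_mul, mul_pow] at h3
  have hk1 : 0 < ‖k‖ ^ 2 := by have := norm_pos_iff.2 hk0; positivity
  have h4 : ‖f ((z.re : ℍ) + (z.im : ℍ) * I)‖ ^ 2 ≤ 1 := by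
    by_contra! h
    nlinarith
  nlinarith [norm_nonneg (f ((z.re : ℍ) + (z.im : ℍ) * I))]

/-! ### Blaschke factors -/

lemma splitF_one_sub_mul_star (a : ℍ) (z : ℂ) :
    splitF (fun q => 1 - q * star a) z = 1 - z * star (⟨a.re, a.imI⟩ : ℂ) := by
  apply Complex.ext <;> simp [splitF]

lemma splitG_one_sub_mul_star (a : ℍ) (z : ℂ) :
    splitG (fun q => 1 - q * star a) z = z * ⟨a.imJ, a.imK⟩ := by
  apply Complex.ext <;> simp [splitG] <;> ring

lemma splitF_sub_mul (a c : ℍ) (z : ℂ) :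
    splitF (fun q => (a - q) * c) z =
      ((⟨a.re, a.imI⟩ : ℂ) - z) * ⟨c.re, c.imI⟩ - ⟨a.imJ, a.imK⟩ * star (⟨c.imJ, c.imK⟩ : ℂ) := by
  apply Complex.ext <;> simp [splitF] <;> ring

lemma splitG_sub_mul (a c : ℍ) (z : ℂ) :
    splitG (fun q => (a - q) * c) z =
      ((⟨a.re, a.imI⟩ : ℂ) - z) * ⟨c.imJ, c.imK⟩ + ⟨a.imJ, a.imK⟩ * star (⟨c.re, c.imI⟩ : ℂ) := by
  apply Complex.ext <;> simp [splitG] <;> ring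

/-- The determinant is `1 - 2 Re(a) z + |a|² z²`; `sliceRep a` has the same real part and modulus as
`a`, hence the factorization. -/
lemma sliceDet_one_sub_mul_star (a : ℍ) (z : ℂ) :
    sliceDet (fun q => 1 - q * star a) z =
      (1 - sliceRep a * z) * (1 - star (sliceRep a) * z) := by
  have hn := norm_sq_eq a.im
  simp only [Quaternion.re_im, Quaternion.imI_im, Quaternion.imJ_im, Quaternion.imK_im] at hn
  simp only [sliceDet, splitF_one_sub_mul_star, splitG_one_sub_mul_star, star_sub, star_mul',
    star_star, star_one]
  have h1 : sliceRep a + star (sliceRep a) = (⟨a.re, a.imI⟩ : ℂ) + star (⟨a.re, a.imI⟩ : ℂ) := by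
    apply Complex.ext <;> simp [sliceRep]
  have h2 : sliceRep a * star (sliceRep a) = (⟨a.re, a.imI⟩ : ℂ) * star (⟨a.re, a.imI⟩ : ℂ) +
      (⟨a.imJ, a.imK⟩ : ℂ) * star (⟨a.imJ, a.imK⟩ : ℂ) := by
    apply Complex.ext <;> simp [sliceRep] <;> linarith
  linear_combination z * h1 - z ^ 2 * h2

lemma one_sub_mul_ne_zero {ρ z : ℂ} (hρ : ‖ρ‖ < 1) (hz : ‖z‖ ≤ 1) : 1 - ρ * z ≠ 0 := by
  rw [sub_ne_zero]
  intro h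
  have := congrArg norm h
  rw [norm_one, norm_mul] at this
  nlinarith [norm_nonneg ρ, norm_nonneg z]

lemma norm_star_complex (z : ℂ) : ‖star z‖ = ‖z‖ := Complex.norm_conj z

lemma sliceDet_one_sub_mul_star_ne_zero {a : ℍ} (ha : ‖a‖ < 1) {z : ℂ} (hz : ‖z‖ ≤ 1) :
    sliceDet (fun q => 1 - q * star a) z ≠ 0 := by
  rw [sliceDet_one_sub_mul_star]
  have := norm_sliceRep a
  exact mul_ne_zero (one_sub_mul_ne_zero (by rwa [this]) hz)
    (one_sub_mul_ne_zero (by rwa [norm_star_complex, this]) hz)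

/-- Inverse matrix as adjugate over determinant. -/
lemma starInv_coeComplex (f : ℍ → ℍ) (z : ℂ) :
    starInv f z = (((sliceDet f z)⁻¹ * star (splitF f (star z)) : ℂ) : ℍ) +
      ((-((sliceDet f z)⁻¹ * splitG f z) : ℂ) : ℍ) * qj := by
  have h : ((sliceDet f z : ℂ) : ℍ)⁻¹ = (((sliceDet f z)⁻¹ : ℂ) : ℍ) :=
    (map_inv₀ Quaternion.ofComplex (sliceDet f z)).symm
  rw [starInv, symmetrization_coeComplex, regConj_coeComplex, h, mul_add,
    ← Quaternion.coeComplex_mul, ← mul_assoc, ← Quaternion.coeComplex_mul, mul_neg]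

lemma splitF_starInv (f : ℍ → ℍ) (z : ℂ) :
    splitF (starInv f) z = (sliceDet f z)⁻¹ * star (splitF f (star z)) :=
  (split_of_eq (starInv_coeComplex f z)).1

lemma splitG_starInv (f : ℍ → ℍ) (z : ℂ) :
    splitG (starInv f) z = -((sliceDet f z)⁻¹ * splitG f z) :=
  (split_of_eq (starInv_coeComplex f z)).2

lemma star_sliceDet_star (f : ℍ → ℍ) (z : ℂ) : star (sliceDet f (star z)) = sliceDet f z := by
  simp only [sliceDet, star_star, star_add, star_mul']
  ring

lemma sliceDet_starInv (f : ℍ → ℍ) (z : ℂ) : sliceDet (starInv f) z = (sliceDet f z)⁻¹ := by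
  have h : sliceDet (starInv f) z = (sliceDet f z)⁻¹ * (sliceDet f z)⁻¹ * sliceDet f z := by
    conv_lhs => rw [sliceDet]
    simp only [splitF_starInv, splitG_starInv, star_star, star_neg, star_mul', star_inv₀,
      star_sliceDet_star]
    generalize (sliceDet f z)⁻¹ = d
    rw [sliceDet]
    ring
  rw [h]
  by_cases h0 : sliceDet f z = 0
  · simp [h0]
  · field_simp

/-- Matrix form of `|1 - āz|² - |a - z|² = (1 - |z|²)(1 - |a|²)`; it is the source of contractivity.
-/
lemma norm_row_one_sub_sub_norm_row_sub (α β z u v : ℂ) :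
    Complex.normSq (u * (1 - z * star α) - v * (z * star β)) +
        Complex.normSq (u * (z * β) + v * (1 - z * α)) -
      (Complex.normSq (u * (α - z) - v * star β) + Complex.normSq (u * β + v * (star α - z))) =
    (1 - Complex.normSq z) * (1 - (Complex.normSq α + Complex.normSq β)) *
      (Complex.normSq u + Complex.normSq v) := by
  simp [Complex.normSq_apply]
  ring

/-- Multiplicativity of the quaternion norm in complex coordinates: right multiplication by a unit
constant preserves row norms. -/
lemma normSq_row_unit (x y γ δ : ℂ) :
    Complex.normSq (x * γ - y * star δ) + Complex.normSq (x * δ + y * star γ) =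
      (Complex.normSq x + Complex.normSq y) * (Complex.normSq γ + Complex.normSq δ) := by
  simp [Complex.normSq_apply]
  ring

lemma normSq_components (a : ℍ) :
    Complex.normSq ⟨a.re, a.imI⟩ + Complex.normSq ⟨a.imJ, a.imK⟩ = ‖a‖ ^ 2 := by
  rw [norm_sq_eq, Complex.normSq_apply, Complex.normSq_apply]
  ring

lemma norm_inv_smul_star {a : ℍ} (ha : a ≠ 0) : ‖(‖a‖⁻¹ : ℝ) • star a‖ = 1 := by
  rw [norm_smul, norm_star, norm_inv, norm_norm, inv_mul_cancel₀ (norm_ne_zero_iff.2 ha)]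

lemma isContractiveAt_starMul_starInv {a c : ℍ} (ha : ‖a‖ < 1) (hc : ‖c‖ = 1) {z : ℂ}
    (hz : ‖z‖ ≤ 1) :
    IsContractiveAt (starMul (starInv fun q => 1 - q * star a) (fun q => (a - q) * c)) z := by
  intro u v
  have hD := sliceDet_one_sub_mul_star_ne_zero ha hz
  have hD2 : sliceDet (fun q => 1 - q * star a) z = _ := rfl
  conv_rhs at hD2 => rw [sliceDet]
  rw [rowFst_starMul, rowSnd_starMul]
  set x := rowFst (starInv fun q => 1 - q * star a) z u v with hx
  set y := rowSnd (starInv fun q => 1 - q * star a) z u v with hy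
  have hc2 := normSq_components c
  have ha2 := normSq_components a
  simp only [rowFst, rowSnd, splitF_starInv, splitG_starInv, star_neg, star_mul', star_inv₀,
    star_sliceDet_star, star_star] at hx hy
  simp only [splitF_one_sub_mul_star, splitG_one_sub_mul_star, star_sub, star_mul', star_star,
    star_one] at hx hy hD2
  simp only [rowFst, rowSnd, splitF_sub_mul, splitG_sub_mul, star_sub, star_add, star_mul',
    star_star]
  generalize sliceDet (fun q => 1 - q * star a) z = D at *
  generalize (⟨a.re, a.imI⟩ : ℂ) = α at *
  generalize (⟨a.imJ, a.imK⟩ : ℂ) = β at *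
  generalize (⟨c.re, c.imI⟩ : ℂ) = γ at *
  generalize (⟨c.imJ, c.imK⟩ : ℂ) = δ at *
  -- The vector `(x, y)` is `(u, v)` times the inverse of the matrix of `1 - qā`, so `(u, v)` is
  -- recovered from it and the two row norms can be compared.
  have hu : u = x * (1 - z * star α) - y * (z * star β) := by
    rw [hx, hy]
    field_simp
    rw [hD2]
    ring
  have hv : v = x * (z * β) + y * (1 - z * α) := by
    rw [hx, hy]
    field_simp
    rw [hD2]
    ring
  have h1 := norm_row_one_sub_sub_norm_row_sub α β z x y
  rw [← hu, ← hv, ha2] at h1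
  have h2 := normSq_row_unit (x * (α - z) - y * star β) (x * β + y * (star α - z)) γ δ
  rw [hc2, hc, one_pow, mul_one] at h2
  have h3 : 0 ≤ (1 - Complex.normSq z) * (1 - ‖a‖ ^ 2) * (Complex.normSq x + Complex.normSq y) := by
    have h4 : 0 ≤ 1 - Complex.normSq z := by
      rw [Complex.normSq_eq_norm_sq]; nlinarith [norm_nonneg z]
    have h5 : 0 ≤ 1 - ‖a‖ ^ 2 := by nlinarith [norm_nonneg a]
    have := Complex.normSq_nonneg x
    have := Complex.normSq_nonneg y
    positivity
  calc _ = Complex.normSq ((x * (α - z) - y * star β) * γ - (x * β + y * (star α - z)) * star δ) +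
        Complex.normSq ((x * (α - z) - y * star β) * δ + (x * β + y * (star α - z)) * star γ) := by
        congr 2 <;> ring
    _ ≤ _ := by linarith

lemma blaschkeFactor_of_ne {a : ℍ} (ha : a ≠ 0) : blaschkeFactor a =
    starMul (starInv fun q => 1 - q * star a) (fun q => (a - q) * ((‖a‖⁻¹ : ℝ) • star a)) :=
  if_neg ha

lemma blaschkeFactor_zero : blaschkeFactor 0 = fun q => q := if_pos rfl

lemma splitF_id (z : ℂ) : splitF (fun q => q) z = z := by
  apply Complex.ext <;> simp [splitF]

lemma splitG_id (z : ℂ) : splitG (fun q => q) z = 0 := by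
  apply Complex.ext <;> simp [splitG]

lemma isContractiveAt_blaschkeFactor {a : ℍ} (ha : ‖a‖ < 1) {z : ℂ} (hz : ‖z‖ ≤ 1) :
    IsContractiveAt (blaschkeFactor a) z := by
  by_cases h : a = 0
  · intro u v
    have hz2 : Complex.normSq z ≤ 1 := by
      rw [Complex.normSq_eq_norm_sq]; nlinarith [norm_nonneg z]
    simp only [h, blaschkeFactor_zero, rowFst, rowSnd, splitF_id, splitG_id, star_zero, star_star,
      mul_zero, sub_zero, zero_add, Complex.normSq_mul]
    nlinarith [Complex.normSq_nonneg u, Complex.normSq_nonneg v]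
  · rw [blaschkeFactor_of_ne h]
    exact isContractiveAt_starMul_starInv ha (norm_inv_smul_star h) hz

lemma sliceDet_sub_mul (a c : ℍ) (hc : ‖c‖ = 1) (z : ℂ) :
    sliceDet (fun q => (a - q) * c) z = (sliceRep a - z) * (star (sliceRep a) - z) := by
  have hn := norm_sq_eq a.im
  simp only [Quaternion.re_im, Quaternion.imI_im, Quaternion.imJ_im, Quaternion.imK_im] at hn
  have hc2 := normSq_components c
  have hc3 : (⟨c.re, c.imI⟩ : ℂ) * star (⟨c.re, c.imI⟩ : ℂ) +
      (⟨c.imJ, c.imK⟩ : ℂ) * star (⟨c.imJ, c.imK⟩ : ℂ) = 1 := by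
    have h : ∀ w : ℂ, w * star w = (Complex.normSq w : ℂ) := Complex.mul_conj
    rw [h, h, ← Complex.ofReal_add, hc2, hc, one_pow, Complex.ofReal_one]
  simp only [sliceDet, splitF_sub_mul, splitG_sub_mul, star_sub, star_add, star_mul',
    star_star]
  have h1 : sliceRep a + star (sliceRep a) = (⟨a.re, a.imI⟩ : ℂ) + star (⟨a.re, a.imI⟩ : ℂ) := by
    apply Complex.ext <;> simp [sliceRep]
  have h2 : sliceRep a * star (sliceRep a) = (⟨a.re, a.imI⟩ : ℂ) * star (⟨a.re, a.imI⟩ : ℂ) +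
      (⟨a.imJ, a.imK⟩ : ℂ) * star (⟨a.imJ, a.imK⟩ : ℂ) := by
    apply Complex.ext <;> simp [sliceRep] <;> linarith
  generalize (⟨a.re, a.imI⟩ : ℂ) = α at *
  generalize (⟨a.imJ, a.imK⟩ : ℂ) = β at *
  generalize (⟨c.re, c.imI⟩ : ℂ) = γ at *
  generalize (⟨c.imJ, c.imK⟩ : ℂ) = δ at *
  linear_combination ((α - z) * (star α - z) + β * star β) * hc3 + z * h1 - h2

/-- The unit constant `ā / |a|` has determinant one and drops out, so a single formula covers `a =
0` too. -/
lemma sliceDet_blaschkeFactor (a : ℍ) (z : ℂ) : sliceDet (blaschkeFactor a) z =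
    ((1 - sliceRep a * z) * (1 - star (sliceRep a) * z))⁻¹ *
      ((sliceRep a - z) * (star (sliceRep a) - z)) := by
  by_cases h : a = 0
  · have : sliceRep 0 = 0 := by apply Complex.ext <;> simp [sliceRep]
    simp [h, blaschkeFactor_zero, sliceDet, splitF_id, splitG_id, this]
  · rw [blaschkeFactor_of_ne h, sliceDet_starMul, sliceDet_starInv, sliceDet_one_sub_mul_star,
      sliceDet_sub_mul _ _ (norm_inv_smul_star h)]

lemma norm_sub_eq_norm_one_sub {ρ z : ℂ} (hz : ‖z‖ = 1) : ‖star ρ - z‖ = ‖1 - ρ * z‖ := by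
  have h1 : Complex.normSq z = 1 := by rw [Complex.normSq_eq_norm_sq, hz, one_pow]
  rw [Complex.normSq_apply] at h1
  rw [← sq_eq_sq₀ (norm_nonneg _) (norm_nonneg _), ← Complex.normSq_eq_norm_sq,
    ← Complex.normSq_eq_norm_sq, Complex.normSq_apply, Complex.normSq_apply]
  simp
  linear_combination (1 - ρ.re ^ 2 - ρ.im ^ 2) * h1

lemma norm_sliceDet_blaschkeFactor {a : ℍ} (ha : ‖a‖ < 1) {z : ℂ} (hz : ‖z‖ = 1) :
    ‖sliceDet (blaschkeFactor a) z‖ = 1 := by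
  have hρ := norm_sliceRep a
  have h1 := one_sub_mul_ne_zero (ρ := sliceRep a) (by rwa [hρ]) hz.le
  have h2 := one_sub_mul_ne_zero (ρ := star (sliceRep a)) (by rwa [norm_star_complex, hρ]) hz.le
  have h3 := norm_sub_eq_norm_one_sub (ρ := star (sliceRep a)) hz
  rw [star_star] at h3
  rw [sliceDet_blaschkeFactor, norm_mul, norm_inv, norm_mul, norm_mul, h3,
    norm_sub_eq_norm_one_sub hz]
  rw [mul_comm ‖1 - star (sliceRep a) * z‖]
  exact inv_mul_cancel₀ (mul_ne_zero (norm_ne_zero_iff.2 h1) (norm_ne_zero_iff.2 h2))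

/-! ### Holomorphic splittings -/

/-- Both splitting components of `f` are complex differentiable at `z`. -/
def SplitDiffAt (f : ℍ → ℍ) (z : ℂ) : Prop :=
  DifferentiableAt ℂ (splitF f) z ∧ DifferentiableAt ℂ (splitG f) z

/-- Schwarz reflection: the second row of the matrix is holomorphic along with the first. -/
lemma differentiableAt_star_comp_star {h : ℂ → ℂ} {z : ℂ} (hh : DifferentiableAt ℂ h (star z)) :
    DifferentiableAt ℂ (fun w => star (h (star w))) z := by
  have := hh.star_star
  rwa [star_star] at this

lemma SplitDiffAt.sliceDet {f : ℍ → ℍ} {z : ℂ} (h1 : SplitDiffAt f z)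
    (h2 : SplitDiffAt f (star z)) : DifferentiableAt ℂ (sliceDet f) z :=
  (h1.1.mul (differentiableAt_star_comp_star h2.1)).add
    (h1.2.mul (differentiableAt_star_comp_star h2.2))

lemma SplitDiffAt.starMul {f g : ℍ → ℍ} {z : ℂ} (hf : SplitDiffAt f z) (hg : SplitDiffAt g z)
    (hg' : SplitDiffAt g (star z)) : SplitDiffAt (starMul f g) z := by
  constructor
  · rw [funext (splitF_starMul f g)]
    exact (hf.1.mul hg.1).sub (hf.2.mul (differentiableAt_star_comp_star hg'.2))
  · rw [funext (splitG_starMul f g)]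
    exact (hf.1.mul hg.2).add (hf.2.mul (differentiableAt_star_comp_star hg'.1))

lemma SplitDiffAt.starInv {f : ℍ → ℍ} {z : ℂ} (hf : SplitDiffAt f z)
    (hf' : SplitDiffAt f (star z)) (h0 : SliceRegular.sliceDet f z ≠ 0) :
    SplitDiffAt (starInv f) z := by
  have hd := (hf.sliceDet hf').inv h0
  constructor
  · rw [funext (splitF_starInv f)]
    exact hd.mul (differentiableAt_star_comp_star hf'.1)
  · rw [funext (splitG_starInv f)]
    exact (hd.mul hf.2).neg

lemma splitDiffAt_blaschkeFactor {a : ℍ} (ha : ‖a‖ < 1) {z : ℂ} (hz : ‖z‖ ≤ 1) :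
    SplitDiffAt (blaschkeFactor a) z := by
  by_cases h : a = 0
  · constructor
    · rw [h, blaschkeFactor_zero, funext splitF_id]; fun_prop
    · rw [h, blaschkeFactor_zero, funext splitG_id]; fun_prop
  · have h1 : ∀ w, SplitDiffAt (fun q => 1 - q * star a) w := fun w => by
      constructor
      · rw [funext (splitF_one_sub_mul_star a)]; fun_prop
      · rw [funext (splitG_one_sub_mul_star a)]; fun_prop
    have h2 : ∀ c w, SplitDiffAt (fun q => (a - q) * c) w := fun c w => by
      constructor
      · rw [funext (splitF_sub_mul a c)]; fun_prop
      · rw [funext (splitG_sub_mul a c)]; fun_prop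
    rw [blaschkeFactor_of_ne h]
    exact ((h1 _).starInv (h1 _) (sliceDet_one_sub_mul_star_ne_zero ha hz)).starMul (h2 _ _) (h2 _ _)

/-! ### Finite products -/

lemma splitF_const_one (z : ℂ) : splitF (fun _ => 1) z = 1 := by
  apply Complex.ext <;> simp [splitF]

lemma splitG_const_one (z : ℂ) : splitG (fun _ => 1) z = 0 := by
  apply Complex.ext <;> simp [splitG]

lemma sliceDet_starProd (f : ℕ → ℍ → ℍ) (m n : ℕ) (z : ℂ) :
    sliceDet (starProd f m n) z = ∏ k ∈ Finset.range n, sliceDet (f (m + k)) z := by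
  induction n with
  | zero => simp [starProd, sliceDet, splitF_const_one, splitG_const_one]
  | succ n ih => rw [starProd, sliceDet_starMul, ih, Finset.prod_range_succ]

lemma isContractiveAt_starProd {f : ℕ → ℍ → ℍ} {z : ℂ} (h : ∀ n, IsContractiveAt (f n) z)
    (m n : ℕ) : IsContractiveAt (starProd f m n) z := by
  induction n with
  | zero => intro u v; simp [starProd, rowFst, rowSnd, splitF_const_one, splitG_const_one]
  | succ n ih => exact ih.starMul (h _)

lemma isSliceAt_starProd (f : ℕ → ℍ → ℍ) (m n : ℕ) (z : ℂ) : IsSliceAt (starProd f m n) z := by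
  cases n with
  | zero => exact isSliceAt_const 1 z
  | succ n =>
    rw [starProd, starMul]
    exact isSliceAt_sliceExt _ z

lemma splitDiffAt_starProd {f : ℕ → ℍ → ℍ} (h : ∀ n, ∀ z : ℂ, ‖z‖ ≤ 1 → SplitDiffAt (f n) z)
    (m n : ℕ) {z : ℂ} (hz : ‖z‖ ≤ 1) : SplitDiffAt (starProd f m n) z := by
  induction n with
  | zero =>
    constructor
    · simp only [starProd]; rw [funext splitF_const_one]; fun_prop
    · simp only [starProd]; rw [funext splitG_const_one]; fun_prop
  | succ n ih => exact ih.starMul (h _ _ hz) (h _ _ (by rwa [norm_star_complex]))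

lemma differentiableAt_sliceDet_starProd {f : ℕ → ℍ → ℍ}
    (h : ∀ n, ∀ z : ℂ, ‖z‖ ≤ 1 → SplitDiffAt (f n) z) (m n : ℕ) {z : ℂ} (hz : ‖z‖ ≤ 1) :
    DifferentiableAt ℂ (sliceDet (starProd f m n)) z :=
  (splitDiffAt_starProd h m n hz).sliceDet (splitDiffAt_starProd h m n (by rwa [norm_star_complex]))

lemma norm_split_le (f : ℍ → ℍ) (z : ℂ) : ‖splitF f z‖ ≤ ‖f z‖ ∧ ‖splitG f z‖ ≤ ‖f z‖ := by
  have h := normSq_split_add f z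
  rw [Complex.normSq_eq_norm_sq, Complex.normSq_eq_norm_sq] at h
  constructor <;> refine le_of_sq_le_sq ?_ (norm_nonneg _) <;>
    nlinarith [sq_nonneg ‖splitF f z‖, sq_nonneg ‖splitG f z‖]

/-- Cauchy–Schwarz for `(F, G)` at `z` and at `z̄`. -/
lemma norm_sliceDet_le (f : ℍ → ℍ) (z : ℂ) : ‖sliceDet f z‖ ≤ ‖f z‖ * ‖f (star z : ℂ)‖ := by
  have h1 := normSq_split_add f z
  have h2 := normSq_split_add f (star z)
  rw [Complex.normSq_eq_norm_sq, Complex.normSq_eq_norm_sq] at h1 h2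
  have h3 : ‖sliceDet f z‖ ≤ ‖splitF f z‖ * ‖splitF f (star z)‖ +
      ‖splitG f z‖ * ‖splitG f (star z)‖ := by
    refine (norm_add_le _ _).trans ?_
    rw [norm_mul, norm_mul, norm_star_complex, norm_star_complex]
  refine h3.trans (le_of_sq_le_sq ?_ (by positivity))
  rw [mul_pow, ← h1, ← h2]
  nlinarith [sq_nonneg (‖splitF f z‖ * ‖splitG f (star z)‖ - ‖splitG f z‖ * ‖splitF f (star z)‖)]

/-! ### Limits -/

lemma coeComplex_mem_unitBall {z : ℂ} : (z : ℍ) ∈ unitBall ↔ ‖z‖ < 1 := by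
  rw [unitBall, mem_ball_zero_iff, norm_coeComplex]

lemma add_mul_imUnit_mem_unitBall {I : ℍ} (hI : I ∈ imUnits) {z : ℂ} (hz : ‖z‖ < 1) :
    (z.re : ℍ) + (z.im : ℍ) * I ∈ unitBall := by
  rwa [unitBall, mem_ball_zero_iff, norm_add_mul_imUnit hI]

lemma continuous_coeComplex : Continuous fun z : ℂ => (z : ℍ) :=
  (Isometry.of_dist_eq fun x y => by
    have h : ((x : ℍ) - (y : ℍ)) = ((x - y : ℂ) : ℍ) := (map_sub Quaternion.ofComplex x y).symm
    rw [dist_eq_norm, dist_eq_norm, h, norm_coeComplex]).continuous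

lemma isSliceAt_of_tendsto {P : ℕ → ℍ → ℍ} {B : ℍ → ℍ}
    (hP : ∀ q ∈ unitBall, Tendsto (fun n => P n q) atTop (𝓝 (B q)))
    (hs : ∀ n z, IsSliceAt (P n) z) {z : ℂ} (hz : ‖z‖ < 1) : IsSliceAt B z := by
  intro I hI
  have h1 := hP _ (coeComplex_mem_unitBall.2 hz)
  have h2 := hP (star z : ℂ) (coeComplex_mem_unitBall.2 (by rwa [norm_star_complex]))
  refine tendsto_nhds_unique (hP _ (add_mul_imUnit_mem_unitBall hI hz)) ?_
  simp only [fun n => hs n z I hI]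
  exact ((h1.add h2).const_smul _).add (((h2.sub h1).const_mul _).const_smul _)

lemma differentiableOn_split_of_tendsto {P : ℕ → ℍ → ℍ} {B : ℍ → ℍ}
    (hP : ∀ C : Set ℍ, IsCompact C → C ⊆ unitBall → TendstoUniformlyOn P B atTop C)
    (hd : ∀ n, ∀ z : ℂ, ‖z‖ ≤ 1 → SplitDiffAt (P n) z) :
    DifferentiableOn ℂ (splitF B) (Metric.ball 0 1) ∧
      DifferentiableOn ℂ (splitG B) (Metric.ball 0 1) := by
  -- Taking a component does not increase distances, so locally uniform convergence is inherited and
  -- Weierstrass' theorem applies.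
  have key : ∀ s : (ℍ → ℍ) → ℂ → ℂ, (∀ f g z, ‖s f z - s g z‖ ≤ ‖f z - g z‖) →
      (∀ n, DifferentiableOn ℂ (s (P n)) (Metric.ball 0 1)) →
      DifferentiableOn ℂ (s B) (Metric.ball 0 1) := by
    intro s hs hsd
    refine TendstoLocallyUniformlyOn.differentiableOn (F := fun n => s (P n)) (φ := atTop) ?_
      (Eventually.of_forall hsd) Metric.isOpen_ball
    rw [tendstoLocallyUniformlyOn_iff_forall_isCompact Metric.isOpen_ball]
    intro K hK hKc
    have h1 := hP _ (hKc.image continuous_coeComplex) (by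
      rintro _ ⟨z, hz, rfl⟩
      exact coeComplex_mem_unitBall.2 (mem_ball_zero_iff.1 (hK hz)))
    rw [Metric.tendstoUniformlyOn_iff] at h1 ⊢
    intro ε hε
    filter_upwards [h1 ε hε] with n hn z hz
    rw [dist_eq_norm]
    refine (hs _ _ _).trans_lt ?_
    rw [← dist_eq_norm]
    exact hn _ (mem_image_of_mem _ hz)
  constructor
  · refine key splitF (fun f g z => ?_) fun n z hz =>
      (hd n z (mem_ball_zero_iff.1 hz).le).1.differentiableWithinAt
    convert (norm_split_le (fun q => f q - g q) z).1 using 2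
    apply Complex.ext <;> simp [splitF]
  · refine key splitG (fun f g z => ?_) fun n z hz =>
      (hd n z (mem_ball_zero_iff.1 hz).le).2.differentiableWithinAt
    convert (norm_split_le (fun q => f q - g q) z).2 using 2
    apply Complex.ext <;> simp [splitG]

/-! ### Regularity from holomorphic splittings -/

/-- The inclusion of the slice `ℂ` as a continuous real linear map. -/
def coeCLM : ℂ →L[ℝ] ℍ := Quaternion.ofComplex.toLinearMap.toContinuousLinearMap

lemma coeCLM_apply (z : ℂ) : coeCLM z = (z : ℍ) := rfl

/-- The identification `ℝ × ℝ ≃ ℂ`. -/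
def toC : ℝ × ℝ →L[ℝ] ℂ := Complex.equivRealProdCLM.symm.toContinuousLinearMap

lemma toC_apply (p : ℝ × ℝ) : toC p = ⟨p.1, p.2⟩ := by
  apply Complex.ext <;> simp [toC]

lemma norm_toC_lt_one {p : ℝ × ℝ} : ‖toC p‖ < 1 ↔ p.1 ^ 2 + p.2 ^ 2 < 1 := by
  rw [← sq_lt_one_iff₀ (norm_nonneg _), ← Complex.normSq_eq_norm_sq, toC_apply,
    Complex.normSq_apply, ← sq, ← sq]

/-- The Cauchy–Riemann equation survives the splitting because `j` stands on the right while `i`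
acts on the left. -/
lemma hasFDerivAt_slice {f : ℍ → ℍ} {p : ℝ × ℝ} (hf : SplitDiffAt f (toC p)) :
    ∃ D : ℝ × ℝ →L[ℝ] ℍ, HasFDerivAt (fun p => f (toC p : ℂ)) D p ∧
      D (0, 1) = qi * D (1, 0) := by
  have hF := (hf.1.hasDerivAt.hasFDerivAt.restrictScalars ℝ).comp p toC.hasFDerivAt
  have hG := (hf.2.hasDerivAt.hasFDerivAt.restrictScalars ℝ).comp p toC.hasFDerivAt
  have h := (coeCLM.hasFDerivAt.comp p hF).add ((coeCLM.hasFDerivAt.comp p hG).mul_const' qj)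
  refine ⟨_, h.congr_of_eventuallyEq (Eventually.of_forall fun x => eq_split f (toC x)), ?_⟩
  have h0 : toC (1, 0) = 1 := by rw [toC_apply]; rfl
  have h1 : toC (0, 1) = Complex.I := by rw [toC_apply]; rfl
  have hI : ((Complex.I : ℂ) : ℍ) = qi := by ext <;> simp
  simp [h0, h1, coeCLM_apply, Quaternion.coeComplex_mul, hI, mul_add, mul_assoc]

lemma contDiffOn_slice {f : ℍ → ℍ} (hF : DifferentiableOn ℂ (splitF f) (Metric.ball 0 1))
    (hG : DifferentiableOn ℂ (splitG f) (Metric.ball 0 1)) :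
    ContDiffOn ℝ 1 (fun p : ℝ × ℝ => f (toC p : ℂ)) {p | p.1 ^ 2 + p.2 ^ 2 < 1} := by
  have hm : MapsTo toC {p : ℝ × ℝ | p.1 ^ 2 + p.2 ^ 2 < 1} (Metric.ball 0 1) := fun p hp =>
    mem_ball_zero_iff.2 (norm_toC_lt_one.2 hp)
  have h1 : ∀ {h : ℂ → ℂ}, DifferentiableOn ℂ h (Metric.ball 0 1) →
      ContDiffOn ℝ 1 (fun p : ℝ × ℝ => ((h (toC p) : ℂ) : ℍ)) {p | p.1 ^ 2 + p.2 ^ 2 < 1} :=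
    fun hh => coeCLM.contDiff.comp_contDiffOn
      (((hh.contDiffOn Metric.isOpen_ball).restrict_scalars ℝ).comp toC.contDiff.contDiffOn hm)
  simp only [fun p : ℝ × ℝ => eq_split f (toC p)]
  exact (h1 hF).add ((h1 hG).mul contDiffOn_const)

lemma star_toC (p : ℝ × ℝ) : star (toC p) = toC (p.1, -p.2) := by
  rw [toC_apply, toC_apply]
  apply Complex.ext <;> simp

/-- A slice function with holomorphic splitting components is regular. -/
theorem isSliceRegular_of_splits {f : ℍ → ℍ} (hs : ∀ z : ℂ, ‖z‖ < 1 → IsSliceAt f z)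
    (hF : DifferentiableOn ℂ (splitF f) (Metric.ball 0 1))
    (hG : DifferentiableOn ℂ (splitG f) (Metric.ball 0 1)) : IsSliceRegular f := by
  intro I hI
  have hI2 : I * I = -1 := hI
  have hq2 : qi * qi = -1 := qi_mem_imUnits
  have hopen : IsOpen {p : ℝ × ℝ | p.1 ^ 2 + p.2 ^ 2 < 1} :=
    isOpen_lt (by fun_prop) continuous_const
  let σ : ℝ × ℝ →L[ℝ] ℝ × ℝ :=
    (ContinuousLinearMap.fst ℝ ℝ ℝ).prod (-ContinuousLinearMap.snd ℝ ℝ ℝ)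
  have hσ : ∀ p, σ p = (p.1, -p.2) := fun p => rfl
  have heq : EqOn (fun p : ℝ × ℝ => f ((p.1 : ℍ) + (p.2 : ℍ) * I))
      (fun p => (1 / 2 : ℝ) • (f (toC p : ℂ) + f (toC (σ p) : ℂ)) +
        (1 / 2 : ℝ) • (I * qi * (f (toC (σ p) : ℂ) - f (toC p : ℂ))))
      {p | p.1 ^ 2 + p.2 ^ 2 < 1} := by
    intro p hp
    have := hs (toC p) (norm_toC_lt_one.2 hp) I hI
    rw [star_toC, ← hσ] at this
    simpa only [toC_apply] using this
  have hcd := contDiffOn_slice hF hG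
  constructor
  · refine ContDiffOn.congr ?_ heq
    have hcd2 : ContDiffOn ℝ 1 (fun p : ℝ × ℝ => f (toC (σ p) : ℂ)) {p | p.1 ^ 2 + p.2 ^ 2 < 1} :=
      hcd.comp σ.contDiff.contDiffOn fun p hp => by
        simpa [hσ] using hp
    exact ((hcd.add hcd2).const_smul _).add ((contDiffOn_const.mul (hcd2.sub hcd)).const_smul _)
  · intro p hp
    have hd : ∀ p : ℝ × ℝ, p.1 ^ 2 + p.2 ^ 2 < 1 → SplitDiffAt f (toC p) := fun p hp =>
      have hn := Metric.isOpen_ball.mem_nhds (mem_ball_zero_iff.2 (norm_toC_lt_one.2 hp))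
      ⟨hF.differentiableAt hn, hG.differentiableAt hn⟩
    obtain ⟨D, hD, hD1⟩ := hasFDerivAt_slice (hd p hp)
    obtain ⟨E, hE, hE1⟩ := hasFDerivAt_slice (p := σ p) (hd (σ p) (by simpa [hσ] using hp))
    have hE2 := hE.comp p σ.hasFDerivAt
    have hfd := ((hD.add hE2).const_smul (1 / 2 : ℝ)).add
      (((hE2.sub hD).const_mul (I * qi)).const_smul (1 / 2 : ℝ))
    have hfd' := HasFDerivAt.congr_of_eventuallyEq hfd
      (heq.eventuallyEq_of_mem (hopen.mem_nhds hp))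
    have hs0 : σ (1, 0) = (1, 0) := by simp [hσ]
    have hs1 : σ (0, 1) = -(0, 1) := by simp [hσ]
    -- With `X = D (1, 0)` and `Y = E (1, 0)`, twice the `x`-derivative is `X + Y + Ii(Y - X)` and
    -- twice the `y`-derivative is `i(X - Y) + I(X + Y)`; multiplying the latter by `I` gives the
    -- negative of the former.
    rw [hfd'.fderiv]
    simp only [add_apply, smul_apply,
      sub_apply, ContinuousLinearMap.comp_apply, hs0, hs1, map_neg, hE1, hD1,
      smul_eq_mul]
    rw [mul_add, mul_smul_comm, mul_smul_comm, ← smul_add, ← smul_add, ← smul_add]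
    have h1 : ∀ x : ℍ, I * (I * qi * x) = -(qi * x) := fun x => by
      rw [← mul_assoc, ← mul_assoc, hI2]; noncomm_ring
    have h2 : ∀ x : ℍ, I * qi * (qi * x) = -(I * x) := fun x => by
      rw [mul_assoc, ← mul_assoc qi, hq2]; noncomm_ring
    convert smul_zero (1 / 2 : ℝ)
    rw [h1]
    simp only [mul_sub, mul_add, mul_neg]
    have h3 : ∀ x : ℍ, qi * (qi * x) = -x := fun x => by
      rw [← mul_assoc, hq2]; noncomm_ring
    rw [h3, h3]
    noncomm_ring

/-! ### Boundary modulus from circle means -/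

lemma ae_of_ae_restrict_Ioc_of_periodic {p : ℝ → Prop} (hp : ∀ θ, p (θ + 2 * Real.pi) ↔ p θ)
    (h : ∀ᵐ θ ∂(volume.restrict (Ioc 0 (2 * Real.pi))), p θ) : ∀ᵐ θ : ℝ, p θ := by
  rw [ae_restrict_iff' measurableSet_Ioc] at h
  have hper : Function.Periodic p (2 * Real.pi) := fun θ => propext (hp θ)
  have h2 : ∀ k : ℤ, ∀ᵐ θ : ℝ, θ - k • (2 * Real.pi) ∈ Ioc 0 (2 * Real.pi) →
      p (θ - k • (2 * Real.pi)) := fun k =>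
    (measurePreserving_sub_right volume (k • (2 * Real.pi))).quasiMeasurePreserving.ae h
  filter_upwards [ae_all_iff.2 h2] with θ hθ
  obtain ⟨k, hk, _⟩ := existsUnique_sub_zsmul_mem_Ioc Real.two_pi_pos θ 0
  have := hθ k (by simpa using hk)
  rwa [hper.sub_zsmul_eq] at this

lemma circleMap_eq (r θ : ℝ) : circleMap 0 r θ = r * Complex.exp (θ * Complex.I) := by
  simp [circleMap]

/-- If the circle means of the modulus of a function bounded by one tend to one, then its radial
limits have modulus one almost everywhere. -/
lemma ae_norm_radial_limit_eq_one {d : ℂ → ℂ} (hd : ContinuousOn d (Metric.ball 0 1))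
    (hd1 : ∀ z ∈ Metric.ball (0 : ℂ) 1, ‖d z‖ ≤ 1)
    (hmean : ∀ ε > 0, ∀ᶠ r in 𝓝[<] (1 : ℝ),
      2 * Real.pi - ε ≤ ∫ θ in (0 : ℝ)..2 * Real.pi, ‖d (circleMap 0 r θ)‖) :
    ∀ᵐ θ : ℝ, ∀ L : ℂ, Tendsto (fun r : ℝ => d (r * Complex.exp (θ * Complex.I))) (𝓝[<] 1) (𝓝 L) →
      ‖L‖ = 1 := by
  refine ae_of_ae_restrict_Ioc_of_periodic (fun θ => ?_) ?_
  · have : Complex.exp (((θ + 2 * Real.pi : ℝ) : ℂ) * Complex.I) = Complex.exp (θ * Complex.I) := by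
      push_cast
      rw [add_mul, Complex.exp_add, Complex.exp_two_pi_mul_I, mul_one]
    rw [this]
  set μ := volume.restrict (Ioc 0 (2 * Real.pi)) with hμ
  -- The shift by `2` keeps every radius strictly between `0` and `1`, including the first.
  let ρ : ℕ → ℝ := fun n => 1 - 1 / ((n : ℝ) + 2)
  have hρ0 : ∀ n, ρ n ∈ Ioo (0 : ℝ) 1 := fun n => by
    have h2 : (0 : ℝ) < (n : ℝ) + 2 := by positivity
    constructor
    · simp only [ρ, sub_pos, div_lt_one h2]; linarith [(Nat.cast_nonneg n : (0 : ℝ) ≤ n)]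
    · simp only [ρ, sub_lt_self_iff]; positivity
  have hρ : Tendsto ρ atTop (𝓝[<] 1) := by
    refine tendsto_nhdsWithin_iff.2 ⟨?_, Eventually.of_forall fun n => (hρ0 n).2⟩
    have h1 : Tendsto (fun n : ℕ => 1 / ((n : ℝ) + 2)) atTop (𝓝 0) := by
      simpa [Function.comp_def] using (tendsto_const_div_atTop_nhds_zero_nat (1 : ℝ)).comp (tendsto_add_atTop_nat 2)
    simpa [ρ] using h1.const_sub 1
  have hmem : ∀ n θ, circleMap 0 (ρ n) θ ∈ Metric.ball (0 : ℂ) 1 := fun n θ => by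
    rw [mem_ball_zero_iff, norm_circleMap_zero, abs_of_pos (hρ0 n).1]; exact (hρ0 n).2
  have hcont : ∀ n, Continuous fun θ => ‖d (circleMap 0 (ρ n) θ)‖ := fun n =>
    (hd.comp_continuous (continuous_circleMap _ _) (hmem n)).norm
  let g : ℕ → ℝ → ENNReal := fun n θ => ENNReal.ofReal (1 - ‖d (circleMap 0 (ρ n) θ)‖)
  have hg : ∀ n, Measurable (g n) := fun n =>
    ENNReal.measurable_ofReal.comp (continuous_const.sub (hcont n)).measurable
  have hint : ∀ n, ∫⁻ θ, g n θ ∂μ =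
      ENNReal.ofReal (2 * Real.pi - ∫ θ in (0 : ℝ)..2 * Real.pi, ‖d (circleMap 0 (ρ n) θ)‖) := by
    intro n
    have hi : IntervalIntegrable (fun θ => ‖d (circleMap 0 (ρ n) θ)‖) volume 0 (2 * Real.pi) :=
      (hcont n).intervalIntegrable _ _
    have h1 : ∫ θ in (0 : ℝ)..2 * Real.pi, (1 - ‖d (circleMap 0 (ρ n) θ)‖) =
        2 * Real.pi - ∫ θ in (0 : ℝ)..2 * Real.pi, ‖d (circleMap 0 (ρ n) θ)‖ := by
      rw [intervalIntegral.integral_sub (by simp) hi]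
      simp
    rw [← h1, intervalIntegral.integral_of_le Real.two_pi_pos.le]
    refine (ofReal_integral_eq_lintegral_ofReal ?_ (ae_of_all _ fun θ => ?_)).symm
    · exact ((continuous_const.sub (hcont n)).intervalIntegrable 0 (2 * Real.pi)).1
    · exact sub_nonneg.2 (hd1 _ (hmem n θ))
  have hlim : Tendsto (fun n => ∫⁻ θ, g n θ ∂μ) atTop (𝓝 0) := by
    rw [ENNReal.tendsto_nhds_zero]
    intro ε hε
    rcases eq_or_ne ε ⊤ with rfl | hε'
    · simp
    filter_upwards [hρ.eventually (hmean ε.toReal (ENNReal.toReal_pos hε.ne' hε'))] with n hn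
    rw [hint]
    exact ENNReal.ofReal_le_of_le_toReal (by linarith)
  -- Fatou's lemma for the nonnegative functions `1 - |d|`, whose integrals tend to zero.
  have h0 : ∫⁻ θ, liminf (fun n => g n θ) atTop ∂μ = 0 :=
    le_antisymm ((lintegral_liminf_le hg).trans hlim.liminf_eq.le) zero_le
  rw [lintegral_eq_zero_iff (Measurable.liminf hg)] at h0
  filter_upwards [h0] with θ hθ L hL
  have h1 := hL.comp hρ
  simp only [Function.comp_def, ← circleMap_eq] at h1
  have h2 : Tendsto (fun n => g n θ) atTop (𝓝 (ENNReal.ofReal (1 - ‖L‖))) :=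
    ENNReal.tendsto_ofReal (h1.norm.const_sub 1)
  rw [h2.liminf_eq, Pi.zero_apply, ENNReal.ofReal_eq_zero] at hθ
  have h3 : ‖L‖ ≤ 1 := le_of_tendsto' h1.norm fun n => hd1 _ (hmem n θ)
  linarith

/-- Lower bound for the circle mean of the modulus of a product of two holomorphic functions. -/
lemma le_integral_norm_mul {p g : ℂ → ℂ} {r s t : ℝ} (hr : 0 < r)
    (hg : DiffContOnCl ℂ g (Metric.ball 0 r)) (hp : ContinuousOn p (Metric.sphere 0 r))
    (hs : 0 ≤ s) (hps : ∀ z : ℂ, ‖z‖ = r → s ≤ ‖p z‖) (ht : t ≤ ‖g 0‖) :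
    2 * Real.pi * (s * t) ≤ ∫ θ in (0 : ℝ)..2 * Real.pi, ‖p (circleMap 0 r θ) * g (circleMap 0 r θ)‖ := by
  have hsph : ∀ θ, circleMap 0 r θ ∈ Metric.sphere (0 : ℂ) r := circleMap_mem_sphere 0 hr.le
  have hgc : Continuous fun θ => g (circleMap 0 r θ) :=
    hg.continuousOn.comp_continuous (continuous_circleMap _ _) fun θ => by
      rw [closure_ball _ hr.ne']; exact Metric.sphere_subset_closedBall (hsph θ)
  have hpc : Continuous fun θ => p (circleMap 0 r θ) :=
    hp.comp_continuous (continuous_circleMap _ _) hsph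
  have h1 : Real.circleAverage g 0 r = g 0 := DiffContOnCl.circleAverage (by rwa [abs_of_pos hr])
  rw [Real.circleAverage_def] at h1
  have h2 : 2 * Real.pi * ‖g 0‖ ≤ ∫ θ in (0 : ℝ)..2 * Real.pi, ‖g (circleMap 0 r θ)‖ := by
    have h3 := intervalIntegral.norm_integral_le_integral_norm (μ := volume)
      (f := fun θ => g (circleMap 0 r θ)) Real.two_pi_pos.le
    rw [← h1, norm_smul, norm_inv, Real.norm_of_nonneg Real.two_pi_pos.le, ← mul_assoc,
      mul_inv_cancel₀ Real.two_pi_pos.ne', one_mul]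
    exact h3
  calc 2 * Real.pi * (s * t) ≤ s * (2 * Real.pi * ‖g 0‖) := by
        have := mul_le_mul_of_nonneg_left ht (mul_nonneg hs Real.two_pi_pos.le)
        linarith
    _ ≤ s * ∫ θ in (0 : ℝ)..2 * Real.pi, ‖g (circleMap 0 r θ)‖ := by gcongr
    _ = ∫ θ in (0 : ℝ)..2 * Real.pi, s * ‖g (circleMap 0 r θ)‖ :=
        (intervalIntegral.integral_const_mul _ _).symm
    _ ≤ _ := by
        refine intervalIntegral.integral_mono_on Real.two_pi_pos.le
          ((continuous_const.mul hgc.norm).intervalIntegrable _ _)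
          ((hpc.mul hgc).norm.intervalIntegrable _ _) fun θ _ => ?_
        rw [norm_mul]
        exact mul_le_mul_of_nonneg_right (hps _ (mem_sphere_zero_iff_norm.1 (hsph θ)))
          (norm_nonneg _)

/-- A continuous function on the closed disc of modulus one on the circle has modulus close to
one near the circle. -/
lemma eventually_forall_norm_ge {p : ℂ → ℂ} (hp : ContinuousOn p (Metric.closedBall 0 1))
    (h1 : ∀ z : ℂ, ‖z‖ = 1 → ‖p z‖ = 1) {ε : ℝ} (hε : 0 < ε) :
    ∀ᶠ r in 𝓝[<] (1 : ℝ), ∀ z : ℂ, ‖z‖ = r → 1 - ε ≤ ‖p z‖ := by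
  have hu := (isCompact_closedBall (0 : ℂ) 1).uniformContinuousOn_of_continuous hp
  obtain ⟨δ, hδ, hu⟩ := Metric.uniformContinuousOn_iff.1 hu ε hε
  have h2 : Ioo (max 0 (1 - δ)) 1 ∈ 𝓝[<] (1 : ℝ) := Ioo_mem_nhdsLT (by simp [hδ])
  filter_upwards [h2] with r hr z hz
  have hr0 : 0 < r := (le_max_left _ _).trans_lt hr.1
  have hrδ : 1 - δ < r := (le_max_right _ _).trans_lt hr.1
  set w : ℂ := ((r⁻¹ : ℝ) : ℂ) * z
  have hw : ‖w‖ = 1 := by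
    rw [norm_mul, Complex.norm_real, hz, Real.norm_of_nonneg (by positivity),
      inv_mul_cancel₀ hr0.ne']
  have hzw : dist z w < δ := by
    have : z = (r : ℂ) * w := by
      rw [← mul_assoc, ← Complex.ofReal_mul, mul_inv_cancel₀ hr0.ne', Complex.ofReal_one, one_mul]
    have h3 : z - w = ((r - 1 : ℝ) : ℂ) * w := by
      rw [Complex.ofReal_sub, sub_mul, Complex.ofReal_one, one_mul, ← this]
    rw [dist_eq_norm, h3, norm_mul, hw, mul_one, Complex.norm_real, Real.norm_eq_abs,
      abs_of_neg (by linarith [hr.2])]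
    linarith
  have h4 := hu z (by rw [mem_closedBall_zero_iff, hz]; exact hr.2.le) w
    (by rw [mem_closedBall_zero_iff, hw]) hzw
  have h5 := norm_sub_norm_le (p w) (p z)
  rw [h1 w hw, norm_sub_rev, ← dist_eq_norm] at h5
  linarith

/-! ### Blaschke products -/

/-- The partial products decrease to `c > 0`. Once one of them is below `c (1 + ε)`, all further
factors together multiply to at least `1 / (1 + ε) ≥ 1 - ε`. -/
lemma exists_tail_prod_ge {t : ℕ → ℝ} (h0 : ∀ n, 0 ≤ t n) (h1 : ∀ n, t n ≤ 1) {m : ℕ} {c : ℝ}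
    (hc : 0 < c) (h : Tendsto (fun n => ∏ k ∈ Finset.range n, t (m + k)) atTop (𝓝 c)) {ε : ℝ}
    (hε : 0 < ε) : ∃ M, ∀ n, 1 - ε ≤ ∏ k ∈ Finset.range n, t (M + k) := by
  have hanti : Antitone fun n => ∏ k ∈ Finset.range n, t (m + k) := by
    refine antitone_nat_of_succ_le fun n => ?_
    rw [Finset.prod_range_succ]
    exact mul_le_of_le_one_right (Finset.prod_nonneg fun _ _ => h0 _) (h1 _)
  have hge : ∀ n, c ≤ ∏ k ∈ Finset.range n, t (m + k) := fun n => hanti.le_of_tendsto h n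
  obtain ⟨N, hN⟩ := (h.eventually (gt_mem_nhds (show c < c * (1 + ε) by nlinarith))).exists
  refine ⟨m + N, fun n => ?_⟩
  have h2 := hge (N + n)
  rw [Finset.prod_range_add] at h2
  simp only [← add_assoc] at h2
  have h3 : 0 ≤ ∏ k ∈ Finset.range n, t (m + N + k) := Finset.prod_nonneg fun _ _ => h0 _
  have h4 : c ≤ c * (1 + ε) * ∏ k ∈ Finset.range n, t (m + N + k) :=
    h2.trans (mul_le_mul_of_nonneg_right hN.le h3)
  have h5 : 1 ≤ (1 + ε) * ∏ k ∈ Finset.range n, t (m + N + k) := by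
    refine le_of_mul_le_mul_left ?_ hc
    linarith
  have h6 : ∏ k ∈ Finset.range n, t (m + N + k) ≤ 1 :=
    Finset.prod_le_one (fun _ _ => h0 _) fun _ _ => h1 _
  nlinarith

lemma norm_sliceDet_zero (f : ℍ → ℍ) : ‖sliceDet f 0‖ = ‖f 0‖ ^ 2 := by
  have h := normSq_split_add f 0
  have h1 : ∀ w : ℂ, w * star w = (Complex.normSq w : ℂ) := Complex.mul_conj
  rw [sliceDet, star_zero, h1, h1, ← Complex.ofReal_add, h, Complex.norm_real,
    Real.norm_of_nonneg (sq_nonneg _), Quaternion.coeComplex_zero]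

section Blaschke

variable {a : ℕ → ℍ} {B : ℍ → ℍ}

lemma IsBlaschkeProduct.norm_lt_one (hB : IsBlaschkeProduct a B) (n : ℕ) : ‖a n‖ < 1 :=
  mem_ball_zero_iff.1 (hB.1 n)

lemma IsBlaschkeProduct.tendsto (hB : IsBlaschkeProduct a B) {q : ℍ} (hq : q ∈ unitBall) :
    Tendsto (fun n => starProd (fun n => blaschkeFactor (a n)) 0 n q) atTop (𝓝 (B q)) :=
  (hB.2 {q} isCompact_singleton (singleton_subset_iff.2 hq)).1.tendsto_at rfl

lemma IsBlaschkeProduct.splitDiffAt (hB : IsBlaschkeProduct a B) (n : ℕ) (z : ℂ) (hz : ‖z‖ ≤ 1) :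
    SplitDiffAt (blaschkeFactor (a n)) z :=
  splitDiffAt_blaschkeFactor (hB.norm_lt_one n) hz

lemma IsBlaschkeProduct.isSliceAt (hB : IsBlaschkeProduct a B) {z : ℂ} (hz : ‖z‖ < 1) :
    IsSliceAt B z :=
  isSliceAt_of_tendsto (fun _ hq => hB.tendsto hq) (fun n z => isSliceAt_starProd _ 0 n z) hz

lemma IsBlaschkeProduct.differentiableOn_split (hB : IsBlaschkeProduct a B) :
    DifferentiableOn ℂ (splitF B) (Metric.ball 0 1) ∧
      DifferentiableOn ℂ (splitG B) (Metric.ball 0 1) :=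
  differentiableOn_split_of_tendsto (fun C hC hCb => (hB.2 C hC hCb).1) fun n _ hz =>
    splitDiffAt_starProd hB.splitDiffAt 0 n hz

lemma norm_starProd_blaschkeFactor_le (ha : ∀ n, ‖a n‖ < 1) (m n : ℕ) {q : ℍ}
    (hq : q ∈ unitBall) : ‖starProd (fun n => blaschkeFactor (a n)) m n q‖ ≤ 1 := by
  obtain ⟨I, hI, h⟩ := exists_imUnit_eq q
  have hz : ‖sliceRep q‖ ≤ 1 := by rw [norm_sliceRep]; exact (mem_ball_zero_iff.1 hq).le
  rw [h]
  exact (isContractiveAt_starProd (fun n => isContractiveAt_blaschkeFactor (ha n) hz)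
    m n).norm_le_one (isSliceAt_starProd _ _ _ _) hI

theorem IsBlaschkeProduct.norm_le_one (hB : IsBlaschkeProduct a B) {q : ℍ} (hq : q ∈ unitBall) :
    ‖B q‖ ≤ 1 :=
  le_of_tendsto' (hB.tendsto hq).norm fun n => norm_starProd_blaschkeFactor_le hB.norm_lt_one 0 n hq

lemma star_mem_ball {z : ℂ} (hz : ‖z‖ < 1) : ((star z : ℂ) : ℍ) ∈ unitBall :=
  coeComplex_mem_unitBall.2 (by rwa [norm_star_complex])

lemma norm_sliceDet_le_one {f : ℍ → ℍ} (hf : ∀ q ∈ unitBall, ‖f q‖ ≤ 1) {z : ℂ} (hz : ‖z‖ < 1) :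
    ‖sliceDet f z‖ ≤ 1 :=
  (norm_sliceDet_le f z).trans (mul_le_one₀ (hf _ (coeComplex_mem_unitBall.2 hz)) (norm_nonneg _)
    (hf _ (star_mem_ball hz)))

lemma IsBlaschkeProduct.continuousOn_sliceDet (hB : IsBlaschkeProduct a B) :
    ContinuousOn (sliceDet B) (Metric.ball 0 1) := by
  intro z hz
  have hd : ∀ w : ℂ, ‖w‖ < 1 → SplitDiffAt B w := fun w hw =>
    have hn := Metric.isOpen_ball.mem_nhds (mem_ball_zero_iff.2 hw)
    ⟨hB.differentiableOn_split.1.differentiableAt hn,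
      hB.differentiableOn_split.2.differentiableAt hn⟩
  have hz1 := mem_ball_zero_iff.1 hz
  exact ((hd z hz1).sliceDet (hd _ (by rwa [norm_star_complex]))).continuousAt.continuousWithinAt

lemma tendsto_sliceDet {P : ℕ → ℍ → ℍ}
    (hP : ∀ q ∈ unitBall, Tendsto (fun n => P n q) atTop (𝓝 (B q))) {z : ℂ} (hz : ‖z‖ < 1) :
    Tendsto (fun n => sliceDet (P n) z) atTop (𝓝 (sliceDet B z)) := by
  have key : ∀ w : ℂ, ‖w‖ < 1 → Tendsto (fun n => splitF (P n) w) atTop (𝓝 (splitF B w)) ∧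
      Tendsto (fun n => splitG (P n) w) atTop (𝓝 (splitG B w)) := by
    intro w hw
    have h := hP _ (coeComplex_mem_unitBall.2 hw)
    have hmk : ∀ {x y : ℕ → ℝ} {x0 y0 : ℝ}, Tendsto x atTop (𝓝 x0) → Tendsto y atTop (𝓝 y0) →
        Tendsto (fun n => (⟨x n, y n⟩ : ℂ)) atTop (𝓝 ⟨x0, y0⟩) := fun hx hy =>
      (Complex.equivRealProdCLM.symm.continuous.tendsto _).comp (hx.prodMk_nhds hy)
    exact ⟨hmk ((Quaternion.continuous_re.tendsto _).comp h)
        ((Quaternion.continuous_imI.tendsto _).comp h),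
      hmk ((Quaternion.continuous_imJ.tendsto _).comp h)
        ((Quaternion.continuous_imK.tendsto _).comp h)⟩
  have h1 := key z hz
  have h2 := key (star z) (by rwa [norm_star_complex])
  exact (h1.1.mul h2.1.star).add (h1.2.mul h2.2.star)

/-- The nonvanishing clause in the convergence of the product enters here, on the compact set `{0}`:
it makes the limit of the residual determinants at `0` nonzero. -/
lemma IsBlaschkeProduct.exists_tail (hB : IsBlaschkeProduct a B) {ε : ℝ} (hε : 0 < ε) :
    ∃ M, ∀ n, 1 - ε ≤ ‖sliceDet (starProd (fun n => blaschkeFactor (a n)) M n) 0‖ := by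
  have h0 : (0 : ℍ) ∈ unitBall := by simp [unitBall]
  obtain ⟨m, -, R, hR, hR0⟩ := (hB.2 {0} isCompact_singleton (singleton_subset_iff.2 h0)).2
  have h1 : Tendsto (fun n => ∏ k ∈ Finset.range n, ‖sliceDet (blaschkeFactor (a (m + k))) 0‖)
      atTop (𝓝 (‖R 0‖ ^ 2)) := by
    refine ((hR.tendsto_at rfl).norm.pow 2).congr fun n => ?_
    rw [← norm_sliceDet_zero, sliceDet_starProd, norm_prod]
  have h2 : 0 < ‖R 0‖ ^ 2 := by have := norm_pos_iff.2 (hR0 0 rfl); positivity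
  have h3 : ∀ n, ‖sliceDet (blaschkeFactor (a n)) 0‖ ≤ 1 := fun n => by
    have hn := hB.norm_lt_one n
    rw [sliceDet_blaschkeFactor]
    simp only [mul_zero, sub_zero, mul_one, inv_one, one_mul]
    rw [norm_mul, norm_star_complex, norm_sliceRep]
    exact mul_le_one₀ hn.le (norm_nonneg _) hn.le
  obtain ⟨M, hM⟩ := exists_tail_prod_ge (t := fun n => ‖sliceDet (blaschkeFactor (a n)) 0‖)
    (fun _ => norm_nonneg _) h3 h2 h1 hε
  refine ⟨M, fun n => ?_⟩
  rw [sliceDet_starProd, norm_prod]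
  exact hM n

lemma starProd_sliceDet_add (f : ℕ → ℍ → ℍ) (M n : ℕ) (z : ℂ) :
    sliceDet (starProd f 0 (M + n)) z = sliceDet (starProd f 0 M) z * sliceDet (starProd f M n) z := by
  simp only [sliceDet_starProd, Finset.prod_range_add, zero_add]

/-- The determinant of a long partial product splits into a fixed head, of modulus near one close to
the circle, and a tail whose mean modulus is at least its modulus at `0`. The bound is uniform in
the length, and dominated convergence carries it to `B`. -/
lemma IsBlaschkeProduct.mean_ge (hB : IsBlaschkeProduct a B) {ε : ℝ} (hε : 0 < ε) :
    ∀ᶠ r in 𝓝[<] (1 : ℝ),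
      2 * Real.pi - ε ≤ ∫ θ in (0 : ℝ)..2 * Real.pi, ‖sliceDet B (circleMap 0 r θ)‖ := by
  have hpi := Real.pi_pos
  set f : ℕ → ℍ → ℍ := fun n => blaschkeFactor (a n) with hf
  -- Chosen so that `2π(1 - η)² ≥ 2π - 4πη ≥ 2π - ε`, with `1 - η` still nonnegative.
  set η : ℝ := min 1 (ε / (4 * Real.pi))
  have hη : 0 < η := lt_min one_pos (by positivity)
  have hη1 : η ≤ 1 := min_le_left _ _
  have hη2 : 4 * Real.pi * η ≤ ε := by
    have := min_le_right 1 (ε / (4 * Real.pi))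
    rw [le_div_iff₀ (by positivity)] at this
    linarith
  obtain ⟨M, hM⟩ := hB.exists_tail hη
  have hdiff : ∀ m n, ∀ z : ℂ, ‖z‖ ≤ 1 → DifferentiableAt ℂ (sliceDet (starProd f m n)) z :=
    fun m n _ hz => differentiableAt_sliceDet_starProd hB.splitDiffAt m n hz
  have hdc : ∀ m n, ContinuousOn (sliceDet (starProd f m n)) (Metric.closedBall 0 1) :=
    fun m n z hz => (hdiff m n z (mem_closedBall_zero_iff.1 hz)).continuousAt.continuousWithinAt
  have hev := eventually_forall_norm_ge (hdc 0 M) (fun z hz => by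
    rw [sliceDet_starProd, norm_prod]
    exact Finset.prod_eq_one fun k _ => norm_sliceDet_blaschkeFactor (hB.norm_lt_one _) hz) hη
  filter_upwards [hev, Ioo_mem_nhdsLT (zero_lt_one' ℝ)] with r hr hr1
  have hsub : Metric.closedBall (0 : ℂ) r ⊆ Metric.closedBall 0 1 :=
    Metric.closedBall_subset_closedBall hr1.2.le
  have hle : ∀ n, 2 * Real.pi - ε ≤
      ∫ θ in (0 : ℝ)..2 * Real.pi, ‖sliceDet (starProd f 0 (M + n)) (circleMap 0 r θ)‖ := by
    intro n
    have h1 := le_integral_norm_mul (p := sliceDet (starProd f 0 M))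
      (g := sliceDet (starProd f M n)) (s := 1 - η) (t := 1 - η) hr1.1
      (by
        refine ⟨fun z hz => (hdiff M n z ?_).differentiableWithinAt, ?_⟩
        · exact (mem_ball_zero_iff.1 hz).le.trans hr1.2.le
        · rw [closure_ball _ hr1.1.ne']; exact (hdc M n).mono hsub)
      ((hdc 0 M).mono (Metric.sphere_subset_closedBall.trans hsub)) (by linarith) hr (hM n)
    simp only [← starProd_sliceDet_add] at h1
    refine le_trans ?_ h1
    nlinarith [mul_nonneg hpi.le (sq_nonneg η)]
  have hcm : ∀ θ, ‖circleMap 0 r θ‖ < 1 := fun θ => by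
    rw [norm_circleMap_zero, abs_of_pos hr1.1]; exact hr1.2
  have hlim : Tendsto (fun n => ∫ θ in (0 : ℝ)..2 * Real.pi,
      ‖sliceDet (starProd f 0 (M + n)) (circleMap 0 r θ)‖) atTop
      (𝓝 (∫ θ in (0 : ℝ)..2 * Real.pi, ‖sliceDet B (circleMap 0 r θ)‖)) := by
    refine intervalIntegral.tendsto_integral_filter_of_dominated_convergence (fun _ => (1 : ℝ))
      (Eventually.of_forall fun n => ?_) (Eventually.of_forall fun n => ae_of_all _ fun θ _ => ?_)
      (by simp) (ae_of_all _ fun θ _ => ?_)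
    · refine Continuous.aestronglyMeasurable (Continuous.norm ?_)
      exact (hdc 0 (M + n)).comp_continuous (continuous_circleMap _ _) fun θ =>
        mem_closedBall_zero_iff.2 (hcm θ).le
    · rw [norm_norm]
      exact norm_sliceDet_le_one (fun q hq => norm_starProd_blaschkeFactor_le hB.norm_lt_one _ _ hq)
        (hcm θ)
    · have h2 := tendsto_sliceDet (fun q hq => hB.tendsto hq) (hcm θ)
      refine (h2.comp (tendsto_add_atTop_nat M)).norm.congr fun n => ?_
      simp only [Function.comp_apply, hf, add_comm n M]
  exact ge_of_tendsto' hlim hle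

/-! ### Radial limits -/

/-- Writing `L = e^{2iφ}`, the coefficient of `A` is `(cos φ + I sin φ) e^{iφ}`, a product of two
unit quaternions. -/
lemma norm_slice_combination {I : ℍ} (hI : I ∈ imUnits) {L : ℂ} (hL : ‖L‖ = 1) (A : ℍ) :
    ‖(1 / 2 : ℝ) • ((L : ℍ) * A + A) + (1 / 2 : ℝ) • (I * qi * (A - (L : ℍ) * A))‖ = ‖A‖ := by
  obtain ⟨h1, h2⟩ := mem_imUnits_iff.1 hI
  have h3 : (1 / 2 : ℝ) • ((L : ℍ) * A + A) + (1 / 2 : ℝ) • (I * qi * (A - (L : ℍ) * A)) =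
      ((1 / 2 : ℝ) • ((L : ℍ) + 1 + I * qi * (1 - (L : ℍ)))) * A := by
    rw [smul_mul_assoc, ← smul_add]
    congr 1
    noncomm_ring
  have h4 : ‖(1 / 2 : ℝ) • ((L : ℍ) + 1 + I * qi * (1 - (L : ℍ)))‖ = 1 := by
    have hL2 : L.re * L.re + L.im * L.im = 1 := by
      rw [← Complex.normSq_apply, Complex.normSq_eq_norm_sq, hL, one_pow]
    have h5 : ‖(L : ℍ) + 1 + I * qi * (1 - (L : ℍ))‖ = 2 := by
      rw [← sq_eq_sq₀ (norm_nonneg _) zero_le_two, norm_sq_eq]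
      simp [h1]
      linear_combination ((1 - L.re) ^ 2 + L.im ^ 2) * h2 + (2 + 2 * I.imI) * hL2
    rw [norm_smul, h5]
    norm_num
  rw [h3, norm_mul, h4, one_mul]

/-- Equality case of Cauchy–Schwarz: the squared distance from `(F₁, G₁)` to `L (F₂, G₂)` is at most
`1 + 1 - 2 = 0`. -/
lemma eq_mul_of_norm_eq_one {F₁ G₁ F₂ G₂ L : ℂ} (hL : F₁ * star F₂ + G₁ * star G₂ = L)
    (hL1 : ‖L‖ = 1) (h1 : Complex.normSq F₁ + Complex.normSq G₁ ≤ 1)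
    (h2 : Complex.normSq F₂ + Complex.normSq G₂ ≤ 1) :
    F₁ = L * F₂ ∧ G₁ = L * G₂ ∧ Complex.normSq F₂ + Complex.normSq G₂ = 1 := by
  have hL2 : Complex.normSq L = 1 := by rw [Complex.normSq_eq_norm_sq, hL1, one_pow]
  have h3 : Complex.normSq (F₁ - L * F₂) + Complex.normSq (G₁ - L * G₂) =
      Complex.normSq F₁ + Complex.normSq G₁ +
        Complex.normSq L * (Complex.normSq F₂ + Complex.normSq G₂) -
        2 * ((F₁ * star F₂ + G₁ * star G₂) * star L).re := by
    simp [Complex.normSq_apply]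
    ring
  have h4 : (L * star L).re = 1 := by
    have : L * star L = (Complex.normSq L : ℂ) := Complex.mul_conj L
    rw [this, hL2, Complex.ofReal_one, Complex.one_re]
  rw [hL, h4, hL2, one_mul] at h3
  have h5 := Complex.normSq_nonneg (F₁ - L * F₂)
  have h6 := Complex.normSq_nonneg (G₁ - L * G₂)
  have h7 : F₁ - L * F₂ = 0 := Complex.normSq_eq_zero.1 (by linarith)
  have h8 : G₁ - L * G₂ = 0 := Complex.normSq_eq_zero.1 (by linarith)
  exact ⟨sub_eq_zero.1 h7, sub_eq_zero.1 h8, by linarith⟩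

lemma star_ofReal_mul_exp (r θ : ℝ) : star ((r : ℂ) * Complex.exp (θ * Complex.I)) =
    r * Complex.exp ((-θ : ℝ) * Complex.I) := by
  rw [Complex.star_def, map_mul, Complex.conj_ofReal, ← Complex.exp_conj, map_mul,
    Complex.conj_ofReal, Complex.conj_I]
  push_cast
  ring_nf

theorem IsBlaschkeProduct.ae_radial_limit (hB : IsBlaschkeProduct a B) :
    ∀ᵐ θ : ℝ, ∀ I ∈ imUnits, ∃ L : ℍ,
      HasRadialLimit B ((Real.cos θ : ℍ) + (Real.sin θ : ℍ) * I) L ∧ ‖L‖ = 1 := by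
  have hle : ∀ z ∈ Metric.ball (0 : ℂ) 1, ‖B z‖ ≤ 1 := fun z hz =>
    hB.norm_le_one (coeComplex_mem_unitBall.2 (mem_ball_zero_iff.1 hz))
  have hF := ae_exists_radial_limit hB.differentiableOn_split.1 (C := 1) fun z hz =>
    (norm_split_le B z).1.trans (hle z hz)
  have hG := ae_exists_radial_limit hB.differentiableOn_split.2 (C := 1) fun z hz =>
    (norm_split_le B z).2.trans (hle z hz)
  -- The extension formula also needs the limits at the conjugate point `e^{-iθ}`.
  have hneg := (Measure.measurePreserving_neg (volume : Measure ℝ)).quasiMeasurePreserving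
  have hD := ae_norm_radial_limit_eq_one hB.continuousOn_sliceDet
    (fun z hz => norm_sliceDet_le_one (fun q hq => hB.norm_le_one hq) (mem_ball_zero_iff.1 hz))
    fun ε hε => hB.mean_ge hε
  filter_upwards [hF, hG, hneg.ae hF, hneg.ae hG, hD] with θ ⟨F₁, hF1⟩ ⟨G₁, hG1⟩ ⟨F₂, hF2⟩
    ⟨G₂, hG2⟩ hD I hI
  simp only [← star_ofReal_mul_exp] at hF2 hG2
  have hr : ∀ᶠ r : ℝ in 𝓝[<] 1, ‖(r : ℂ) * Complex.exp (θ * Complex.I)‖ < 1 := by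
    filter_upwards [Ioo_mem_nhdsLT (zero_lt_one' ℝ)] with r hr
    rw [norm_mul, Complex.norm_exp_ofReal_mul_I, mul_one, Complex.norm_real,
      Real.norm_of_nonneg hr.1.le]
    exact hr.2
  have hdet : Tendsto (fun r : ℝ => sliceDet B (r * Complex.exp (θ * Complex.I))) (𝓝[<] 1)
      (𝓝 (F₁ * star F₂ + G₁ * star G₂)) := (hF1.mul hF2.star).add (hG1.mul hG2.star)
  have hbound : ∀ {F G : ℂ} {w : ℝ → ℂ}, Tendsto (fun r => splitF B (w r)) (𝓝[<] 1) (𝓝 F) →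
      Tendsto (fun r => splitG B (w r)) (𝓝[<] 1) (𝓝 G) → (∀ᶠ r in 𝓝[<] 1, ‖w r‖ < 1) →
      Complex.normSq F + Complex.normSq G ≤ 1 := by
    intro F G w hF hG hw
    refine le_of_tendsto (((Complex.continuous_normSq.tendsto _).comp hF).add
      ((Complex.continuous_normSq.tendsto _).comp hG)) ?_
    filter_upwards [hw] with r hr
    simp only [Function.comp_apply]
    rw [normSq_split_add]
    exact pow_le_one₀ (norm_nonneg _) (hle _ (mem_ball_zero_iff.2 hr))
  obtain ⟨e1, e2, e3⟩ := eq_mul_of_norm_eq_one rfl (hD _ hdet) (hbound hF1 hG1 hr)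
    (hbound hF2 hG2 (by simpa only [norm_star_complex] using hr))
  have hL1 := hD _ hdet
  generalize F₁ * star F₂ + G₁ * star G₂ = L at *
  have hval : ∀ {F G : ℂ} {w : ℝ → ℂ}, Tendsto (fun r => splitF B (w r)) (𝓝[<] 1) (𝓝 F) →
      Tendsto (fun r => splitG B (w r)) (𝓝[<] 1) (𝓝 G) →
      Tendsto (fun r => B (w r : ℂ)) (𝓝[<] 1) (𝓝 ((F : ℍ) + (G : ℍ) * qj)) := by
    intro F G w hF hG
    simp only [eq_split B]
    exact ((continuous_coeComplex.tendsto _).comp hF).add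
      (((continuous_coeComplex.tendsto _).comp hG).mul_const _)
  have h1 := hval hF1 hG1
  have h2 := hval hF2 hG2
  set A : ℍ := (F₂ : ℍ) + (G₂ : ℍ) * qj with hA
  have hA1 : ‖A‖ = 1 := by
    rw [← sq_eq_sq₀ (norm_nonneg _) zero_le_one, norm_sq_eq, one_pow]
    refine Eq.trans ?_ e3
    rw [hA, Complex.normSq_apply, Complex.normSq_apply]
    simp
    ring
  have hA2 : (F₁ : ℍ) + (G₁ : ℍ) * qj = (L : ℍ) * A := by
    rw [e1, e2, Quaternion.coeComplex_mul, Quaternion.coeComplex_mul, hA, mul_add, mul_assoc]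
  rw [hA2] at h1
  refine ⟨_, ?_, (norm_slice_combination hI hL1 A).trans hA1⟩
  have h3 := ((h1.add h2).const_smul (1 / 2 : ℝ)).add
    (((h2.sub h1).const_mul (I * qi)).const_smul (1 / 2 : ℝ))
  refine h3.congr' ?_
  filter_upwards [hr] with r hr
  rw [← hB.isSliceAt hr I hI]
  congr 1
  ext <;> simp [Complex.exp_re, Complex.exp_im] <;> ring

end Blaschke

/-! ### Transfer to the surface measure of the 3-sphere -/

lemma ae_im_ne_zero : ∀ᵐ q : ℍ, q.im ≠ 0 := by
  let W : Submodule ℝ ℍ := LinearMap.range (Algebra.linearMap ℝ ℍ)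
  have hW : W ≠ ⊤ := by
    intro h
    obtain ⟨x, hx⟩ : qi ∈ W := h ▸ Submodule.mem_top
    simpa using congrArg (fun q : ℍ => q.imI) hx
  refine measure_mono_null (fun q hq => ?_) (Measure.addHaar_submodule (volume : Measure ℍ) W hW)
  refine ⟨q.re, ?_⟩
  have h0 : q.im = 0 := by simpa using hq
  have := Quaternion.re_add_im q
  rw [h0, add_zero] at this
  exact this

lemma measurable_re_div_norm : Measurable fun q : ℍ => q.re / ‖q‖ :=
  Quaternion.continuous_re.measurable.div continuous_norm.measurable

lemma norm_sq_eq_re_add_im (q : ℍ) : ‖q‖ ^ 2 = q.re ^ 2 + ‖q.im‖ ^ 2 := by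
  rw [norm_sq_eq, norm_sq_eq]
  simp
  ring

lemma sin_arccos_re_div_norm {q : ℍ} (hq : q ≠ 0) :
    Real.sin (Real.arccos (q.re / ‖q‖)) = ‖q.im‖ / ‖q‖ := by
  have hn := norm_pos_iff.2 hq
  have h := norm_sq_eq_re_add_im q
  rw [Real.sin_arccos, show 1 - (q.re / ‖q‖) ^ 2 = (‖q.im‖ / ‖q‖) ^ 2 by field_simp; linarith,
    Real.sqrt_sq (by positivity)]

lemma cos_arccos_re_div_norm {q : ℍ} (hq : q ≠ 0) :
    Real.cos (Real.arccos (q.re / ‖q‖)) = q.re / ‖q‖ := by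
  have hn := norm_pos_iff.2 hq
  have h := norm_sq_eq_re_add_im q
  have h2 : |q.re| ≤ ‖q‖ := abs_le_of_sq_le_sq (by nlinarith [sq_nonneg ‖q.im‖]) hn.le
  obtain ⟨h3, h4⟩ := abs_le.1 h2
  refine Real.cos_arccos ?_ ?_
  · rw [le_div_iff₀ hn]; linarith
  · rw [div_le_iff₀ hn]; linarith

/-- The polar angle of almost every quaternion avoids a given null set. -/
lemma ae_arccos_notMem {N : Set ℝ} (hN : MeasurableSet N) (h0 : volume N = 0) :
    ∀ᵐ q : ℍ, Real.arccos (q.re / ‖q‖) ∉ N := by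
  have hmeas : MeasurableSet {q : ℍ | Real.arccos (q.re / ‖q‖) ∉ N} :=
    (Real.continuous_arccos.measurable.comp measurable_re_div_norm) hN.compl
  -- Fubini along the lines `y + ℝ`: for nonreal `y`, the real translation is a differentiable
  -- function of the polar angle, through the cotangent, so it maps null sets to null sets.
  refine (ae_ae_add_linearMap_mem_iff (Algebra.linearMap ℝ ℍ) (volume : Measure ℝ)
    (volume : Measure ℍ) hmeas).1 ?_
  filter_upwards [ae_im_ne_zero] with y hy
  have hv : 0 < ‖y.im‖ := norm_pos_iff.2 hy
  have hnull : volume ((fun θ : ℝ => ‖y.im‖ * (Real.cos θ / Real.sin θ) - y.re) ''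
      (N ∩ {θ | Real.sin θ ≠ 0})) = 0 := by
    refine addHaar_image_eq_zero_of_differentiableOn_of_addHaar_eq_zero volume ?_
      (measure_mono_null inter_subset_left h0)
    refine DifferentiableOn.sub_const (DifferentiableOn.const_mul ?_ _) _
    exact Real.differentiable_cos.differentiableOn.div Real.differentiable_sin.differentiableOn
      fun θ hθ => hθ.2
  refine measure_mono_null (fun x hx => ?_) hnull
  have hx' : Real.arccos ((y + (x : ℍ)).re / ‖y + (x : ℍ)‖) ∈ N := by
    by_contra h
    exact hx h
  have him : (y + (x : ℍ)).im = y.im := by simp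
  have hq0 : y + (x : ℍ) ≠ 0 := fun h => hy (by rw [← him, h, Quaternion.im_zero])
  have hqn := norm_pos_iff.2 hq0
  have hs := sin_arccos_re_div_norm hq0
  have hc := cos_arccos_re_div_norm hq0
  rw [him] at hs
  refine ⟨_, ⟨hx', ?_⟩, ?_⟩
  · show Real.sin _ ≠ 0
    rw [hs]
    positivity
  · simp only [hs, hc]
    field_simp
    simp

/-- A subset of the sphere is null for surface measure when the cone over it is null in `ℍ`, and the
polar angle is constant along rays. -/
lemma ae_toSphere_of_ae {p : ℝ → Prop} (hp : ∀ᵐ θ : ℝ, p θ) :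
    ∀ᵐ ω : Metric.sphere (0 : ℍ) 1 ∂(volume : Measure ℍ).toSphere,
      p (Real.arccos (ω : ℍ).re) := by
  -- The exceptional set need not be measurable, so a measurable null superset replaces it.
  set N := toMeasurable volume {θ : ℝ | ¬ p θ}
  have hN : MeasurableSet N := measurableSet_toMeasurable _ _
  have hN0 : volume N = 0 := by rw [measure_toMeasurable]; exact hp
  have hS : MeasurableSet {ω : Metric.sphere (0 : ℍ) 1 | Real.arccos (ω : ℍ).re ∈ N} :=
    (Real.continuous_arccos.comp (Quaternion.continuous_re.comp continuous_subtype_val)).measurable hN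
  have h1 : (volume : Measure ℍ).toSphere
      {ω : Metric.sphere (0 : ℍ) 1 | Real.arccos (ω : ℍ).re ∈ N} = 0 := by
    rw [Measure.toSphere_apply' _ hS]
    refine mul_eq_zero_of_right _ (measure_mono_null ?_ (ae_iff.1 (ae_arccos_notMem hN hN0)))
    rintro _ ⟨r, hr, _, ⟨ω, hω, rfl⟩, rfl⟩
    have hn : ‖(ω : ℍ)‖ = 1 := mem_sphere_zero_iff_norm.1 ω.2
    have hr0 : r ≠ 0 := hr.1.ne'
    show ¬ (Real.arccos ((r • (ω : ℍ)).re / ‖r • (ω : ℍ)‖) ∉ N)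
    rw [norm_smul, hn, mul_one, Real.norm_of_nonneg hr.1.le, Quaternion.re_smul, smul_eq_mul,
      mul_div_cancel_left₀ _ hr0]
    exact not_not.2 hω
  refine measure_mono_null (fun ω hω => ?_) h1
  exact subset_toMeasurable volume {θ : ℝ | ¬ p θ} hω

lemma exists_imUnit_eq_cos_add_sin {ω : ℍ} (hω : ‖ω‖ = 1) : ∃ I ∈ imUnits,
    ω = (Real.cos (Real.arccos ω.re) : ℍ) + (Real.sin (Real.arccos ω.re) : ℍ) * I := by
  have h0 : ω ≠ 0 := norm_ne_zero_iff.1 (by rw [hω]; exact one_ne_zero)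
  have hs := sin_arccos_re_div_norm h0
  have hc := cos_arccos_re_div_norm h0
  rw [hω, div_one] at hs hc
  obtain ⟨I, hI, h⟩ := exists_imUnit_eq ω
  refine ⟨I, hI, ?_⟩
  rw [hs, hc, div_one]
  exact h

end SliceRegular

end

theorem mainTheorem4 (a : ℕ → ℍ) (B : ℍ → ℍ) (hB : SliceRegular.IsBlaschkeProduct a B) :
    (∀ q ∈ SliceRegular.unitBall, ‖B q‖ ≤ 1) ∧
    (∀ᵐ θ : ℝ, ∀ I ∈ SliceRegular.imUnits, ∃ L : ℍ,
      SliceRegular.HasRadialLimit B ((Real.cos θ : ℍ) + (Real.sin θ : ℍ) * I) L ∧ ‖L‖ = 1) ∧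
    SliceRegular.IsInner B := by
  have h1 : ∀ q ∈ SliceRegular.unitBall, ‖B q‖ ≤ 1 := fun q hq => hB.norm_le_one hq
  refine ⟨h1, hB.ae_radial_limit, ⟨?_, 1, ?_⟩, h1, ?_⟩
  · exact SliceRegular.isSliceRegular_of_splits (fun z hz => hB.isSliceAt hz)
      hB.differentiableOn_split.1 hB.differentiableOn_split.2
  · rintro _ ⟨q, hq, rfl⟩
    exact h1 q hq
  · filter_upwards [SliceRegular.ae_toSphere_of_ae hB.ae_radial_limit] with ω hω
    obtain ⟨I, hI, h⟩ := SliceRegular.exists_imUnit_eq_cos_add_sin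
      (mem_sphere_zero_iff_norm.1 ω.2)
    rw [h]
    exact hω I hI
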